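/- Let $d\in\{2,3\}$, let $\Omega\subset\mathbb R^d$ be a bounded $C^2$ domain with outward unit normal $\mathbf n$, and let $T,\varepsilon_0,\mu_0,c_0>0$. Let $B_1,\dots,B_m\subset\mathbb R^d$ be bounded smooth domains containing the origin and let $\mu_1,\dots,\mu_m>0$. For points $z_1,\dots,z_m\in\Omega$ satisfying (f1) $|z_j-z_l|\ge c_0$ for all $j\ne l$, and $\operatorname{dist}(z_j,\partial\Omega)\ge c_0$ for all $j$, and for $\alpha>0$ so small that the inhomogeneities $z_j+\alpha B_j$ are disjoint and that their distance to $\mathbb R^d\setminus\overline\Omega$ is larger than $c_0/2$, let $\mu_\alpha$ be equal to $\mu_j$ in $z_j+\alpha B_j$ and to $\mu_0$ elsewhere in $\Omega$. (For $d=2$ the curl of a vector field is the scalar $\partial_1u_2-\partial_2u_1$, the curl of a scalar $p$ is the vector $(\partial_2p,-\partial_1p)$, and $u\times\mathbf n=u_1n_2-u_2n_1$.) Given $\varphi,\psi,f$, let $E\in C^\infty([0,T]\times\overline\Omega)$ be a solution of $$\varepsilon_0\partial_t^2E+\operatorname{curl}\tfrac1{\mu_0}\operatorname{curl}E=0,\quad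 \operatorname{div}(\varepsilon_0E)=0\quad\text{in }\Omega\times(0,T),$$ $$E|_{t=0}=\varphi,\quad \partial_tE|_{t=0}=\psi\quad\text{in }\Omega,\qquad E\times\mathbf n=f\quad\text{on }\partial\Omega\times(0,T).$$ Let $E_\alpha\in C^0([0,T];X(\Omega))\cap C^1([0,T];L^2(\Omega)^d)$, where $X(\Omega)=\{u\in H^1(\Omega)^d:\operatorname{div}u=0\}$, be a weak solution of the same problem (same $\varepsilon_0,\varphi,\psi,f$) with $\mu_0$ replaced by $\mu_\alpha$; weak means that $\frac{d}{dt}\int_\Omega\varepsilon_0\partial_tE_\alpha\cdot v\,dx+\int_\Omega\frac1{\mu_\alpha}\operatorname{curl}E_\alpha\cdot\operatorname{curl}v\,dx=0$ on $(0,T)$ for all $v\in X_N(\Omega)$, where $$X_N(\Omega)=\{v\in H(\operatorname{curl};\Omega)\cap H(\operatorname{div};\Omega):\ v\times\mathbf n=0\text{ on }\partial\Omega\},\qquad \|v\|_{X_N(\Omega)}^2=\|v\|_{L^2(\Omega)}^2+\|\operatorname{curl}v\|_{L^2(\Omega)}^2+\|\operatorname{div}v\|_{L^2(\Omega)}^2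 .$$ Then there is a constant $C>0$, independent of $\alpha$ and of the points $z_1,\dots,z_m$ (it may depend on $d,\Omega,T,\varepsilon_0,\mu_0,c_0$, on the $B_j$ and $\mu_j$, and on the data, that is, on $E$), such that for all points $z_j$ satisfying (f1), all such $\alpha$, and all such $E_\alpha$, $$\|\partial_t(E_\alpha-E)\|_{L^\infty(0,T;L^2(\Omega))}+\|E_\alpha-E\|_{L^\infty(0,T;X_N(\Omega))}\le C\alpha .$$ In particular $E_\alpha-E\in X_N(\Omega)$ for almost every $t\in(0,T)$, and the estimate holds as $\alpha\to0$. -/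

import Mathlib

open MeasureTheory Set
open scoped ContDiff ENNReal RealInnerProductSpace

namespace Maxwell

noncomputable section

/-- Euclidean space `ℝ^d`. -/
abbrev Space (d : ℕ) : Type := EuclideanSpace ℝ (Fin d)

/-- The number of components of the curl of a vector field on `ℝ^d`:
one for `d = 2` (scalar curl) and three for `d = 3`. -/
abbrev curlDim : ℕ → ℕ
  | 2 => 1
  | 3 => 3
  | _ => 0

/-- The space in which curls and cross products of vectors of `ℝ^d` take their values:
`ℝ` (written as `ℝ^1`) for `d = 2` and `ℝ^3` for `d = 3`. -/
abbrev CurlSpace (d : ℕ) : Type := EuclideanSpace ℝ (Fin (curlDim d))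

/-- The cross product of two vectors: `a₀ b₁ - a₁ b₀` for `d = 2`, the usual one for `d = 3`. -/
def cross : (d : ℕ) → Space d → Space d → CurlSpace d
  | 2, a, b => (!₂[a 0 * b 1 - a 1 * b 0] : EuclideanSpace ℝ (Fin 1))
  | 3, a, b => (!₂[a 1 * b 2 - a 2 * b 1, a 2 * b 0 - a 0 * b 2, a 0 * b 1 - a 1 * b 0] :
      EuclideanSpace ℝ (Fin 3))
  | _, _, _ => 0

/-- The cross product of a vector with a curl: the vector `(a₁ p, -a₀ p)` for `d = 2`
(where `p` is a scalar), the usual cross product for `d = 3`. -/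
def cross' : (d : ℕ) → Space d → CurlSpace d → Space d
  | 2, a, p => let q : EuclideanSpace ℝ (Fin 1) := p
      !₂[a 1 * q 0, -(a 0 * q 0)]
  | 3, a, p => let b : EuclideanSpace ℝ (Fin 3) := p
      !₂[a 1 * b 2 - a 2 * b 1, a 2 * b 0 - a 0 * b 2, a 0 * b 1 - a 1 * b 0]
  | _, _, _ => 0

variable {d : ℕ}

/-! Classical differential operators. -/

/-- `curl u = ∇ × u = ∑ i, e_i × ∂_i u`; for `d = 2` this is `∂₀ u₁ - ∂₁ u₀`. -/
def curl (u : Space d → Space d) (x : Space d) : CurlSpace d :=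
  ∑ i, cross d (EuclideanSpace.single i 1) (fderiv ℝ u x (EuclideanSpace.single i 1))

/-- The curl of a `CurlSpace`-valued field; for `d = 2` this is the vector
curl `(∂₁ p, -∂₀ p)` of a scalar `p`, for `d = 3` it is the usual curl. -/
def curl' (p : Space d → CurlSpace d) (x : Space d) : Space d :=
  ∑ i, cross' d (EuclideanSpace.single i 1) (fderiv ℝ p x (EuclideanSpace.single i 1))

/-- The divergence of a vector field. -/
def divergence (u : Space d → Space d) (x : Space d) : ℝ :=
  ∑ i, fderiv ℝ u x (EuclideanSpace.single i 1) i

/-! Domains and normals. -/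

/-- `ρ` is a `C^k` defining function of `Ω` near `x`: `Ω` is `{ρ < 0}` near `x`, and the gradient
of `ρ` does not vanish at `x`. -/
def IsLocalDefiningFunction (k : WithTop ℕ∞) (Ω : Set (Space d)) (x : Space d)
    (ρ : Space d → ℝ) : Prop :=
  ∃ U : Set (Space d), IsOpen U ∧ x ∈ U ∧ ContDiffOn ℝ k ρ U ∧ gradient ρ x ≠ 0 ∧
    ∀ y ∈ U, (y ∈ Ω ↔ ρ y < 0)

/-- Bounded domains (open, connected, non-empty sets) with boundary of class `C^k`. -/
structure IsBoundedDomain (k : WithTop ℕ∞) (Ω : Set (Space d)) : Prop where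
  isOpen : IsOpen Ω
  isConnected : IsConnected Ω
  isBounded : Bornology.IsBounded Ω
  boundary : ∀ x ∈ frontier Ω, ∃ ρ, IsLocalDefiningFunction k Ω x ρ

/-- `n` is the outward unit normal vector to `Ω` at the boundary point `x`. -/
def IsOutwardNormal (Ω : Set (Space d)) (x n : Space d) : Prop :=
  ∃ ρ, IsLocalDefiningFunction 1 Ω x ρ ∧ n = ‖gradient ρ x‖⁻¹ • gradient ρ x

/-- `v × n = g` on `∂Ω`, pointwise. -/
def HasClassicalTangentialTrace (Ω : Set (Space d)) (v : Space d → Space d)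
    (g : Space d → CurlSpace d) : Prop :=
  ∀ x ∈ frontier Ω, ∀ n, IsOutwardNormal Ω x n → cross d (v x) n = g x

/-! Square integrable fields and weak derivatives. -/

/-- The Hilbert space `L²(Ω; F)`. -/
abbrev L2 (Ω : Set (Space d)) (F : Type) [NormedAddCommGroup F] : Type :=
  Lp F 2 ((volume : Measure (Space d)).restrict Ω)

open Classical in
/-- The class in `L²(Ω; F)` of a function which is square integrable on `Ω`. -/
def toL2 (Ω : Set (Space d)) {F : Type} [NormedAddCommGroup F] (u : Space d → F) : L2 Ω F :=
  if h : MemLp u 2 (volume.restrict Ω) then h.toLp u else 0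

/-- Scalar test functions: the elements of `C_c^∞(Ω)`. -/
structure IsTestFunction (Ω : Set (Space d)) (θ : Space d → ℝ) : Prop where
  smooth : ContDiff ℝ ∞ θ
  compact : HasCompactSupport θ
  support : tsupport θ ⊆ Ω

/-- `p = ∂_i u` weakly in `Ω`. -/
def HasWeakPartial (Ω : Set (Space d)) (i : Fin d) (u p : L2 Ω (Space d)) : Prop :=
  ∀ θ, IsTestFunction Ω θ →
    ∫ x in Ω, θ x • p x = -∫ x in Ω, fderiv ℝ θ x (EuclideanSpace.single i 1) • u x

/-- `c = curl u` weakly in `Ω`: `∫ θ c = -∫ ∇θ × u` for all test functions `θ`. -/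
def HasWeakCurl (Ω : Set (Space d)) (u : L2 Ω (Space d)) (c : L2 Ω (CurlSpace d)) : Prop :=
  ∀ θ, IsTestFunction Ω θ →
    ∫ x in Ω, θ x • c x = -∫ x in Ω, cross d (gradient θ x) (u x)

/-- `q = div u` weakly in `Ω`: `∫ θ q = -∫ ∇θ · u` for all test functions `θ`. -/
def HasWeakDiv (Ω : Set (Space d)) (u : L2 Ω (Space d)) (q : L2 Ω ℝ) : Prop :=
  ∀ θ, IsTestFunction Ω θ →
    ∫ x in Ω, θ x * q x = -∫ x in Ω, ⟪gradient θ x, u x⟫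

/-- `u ∈ H¹(Ω)^d`. -/
def MemH1 (Ω : Set (Space d)) (u : L2 Ω (Space d)) : Prop := ∀ i, ∃ p, HasWeakPartial Ω i u p

/-- `u ∈ H(curl; Ω)`. -/
def MemHcurl (Ω : Set (Space d)) (u : L2 Ω (Space d)) : Prop := ∃ c, HasWeakCurl Ω u c

/-- `u ∈ H(div; Ω)`. -/
def MemHdiv (Ω : Set (Space d)) (u : L2 Ω (Space d)) : Prop := ∃ q, HasWeakDiv Ω u q

open Classical in
/-- The weak partial derivative of a field which has one. -/
def weakPartial (Ω : Set (Space d)) (i : Fin d) (u : L2 Ω (Space d)) : L2 Ω (Space d) :=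
  if h : ∃ p, HasWeakPartial Ω i u p then h.choose else 0

open Classical in
/-- The weak curl of a field in `H(curl; Ω)`. -/
def weakCurl (Ω : Set (Space d)) (u : L2 Ω (Space d)) : L2 Ω (CurlSpace d) :=
  if h : MemHcurl Ω u then h.choose else 0

open Classical in
/-- The weak divergence of a field in `H(div; Ω)`. -/
def weakDiv (Ω : Set (Space d)) (u : L2 Ω (Space d)) : L2 Ω ℝ :=
  if h : MemHdiv Ω u then h.choose else 0

/-- `u × n = g` on `∂Ω` for `u ∈ H(curl; Ω)`, in the sense of the continuous extension to
`H(curl; Ω)` of the tangential trace of fields in `C¹` of the closure of `Ω`: the field `u` is a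
limit in `H(curl; Ω)` of such fields with `v × n = g` on `∂Ω`. For `g = 0` the fields `u` of this
kind form the space `H₀(curl; Ω)`. -/
def HasTangentialTrace (Ω : Set (Space d)) (u : L2 Ω (Space d)) (g : Space d → CurlSpace d) :
    Prop :=
  MemHcurl Ω u ∧ ∀ δ : ℝ, 0 < δ → ∃ v : Space d → Space d,
    ContDiffOn ℝ 1 v (closure Ω) ∧ HasClassicalTangentialTrace Ω v g ∧
      ‖u - toL2 Ω v‖ < δ ∧ ‖weakCurl Ω u - toL2 Ω (curl v)‖ < δ

/-- `v ∈ X_N(Ω)`: `v ∈ H(curl; Ω) ∩ H(div; Ω)` and `v × n = 0` on `∂Ω`. -/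
structure MemXN (Ω : Set (Space d)) (v : L2 Ω (Space d)) : Prop where
  curl : MemHcurl Ω v
  div : MemHdiv Ω v
  trace : HasTangentialTrace Ω v 0

open Classical in
/-- The norm of `X_N(Ω)`, with value `∞` outside this space. -/
def normXN (Ω : Set (Space d)) (v : L2 Ω (Space d)) : ℝ≥0∞ :=
  if MemXN Ω v then
    ENNReal.ofReal (√(‖v‖ ^ 2 + ‖weakCurl Ω v‖ ^ 2 + ‖weakDiv Ω v‖ ^ 2))
  else ⊤

/-! The two initial boundary value problems. -/

/-- `E ∈ C^∞([0,T] × closure Ω)` is a classical solution, in the homogeneous medium with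
permittivity `ε` and permeability `μ`, of `ε ∂_t² E + curl (μ⁻¹ curl E) = 0`, `div (ε E) = 0`,
with initial data `φ, ψ` and with `E × n = f` on `∂Ω × (0,T)`. -/
structure IsClassicalSolution (Ω : Set (Space d)) (T ε μ : ℝ) (φ ψ : Space d → Space d)
    (f : ℝ → Space d → CurlSpace d) (E : ℝ → Space d → Space d) : Prop where
  smooth : ContDiffOn ℝ ∞ (fun p : ℝ × Space d => E p.1 p.2) (Icc 0 T ×ˢ closure Ω)
  maxwell : ∀ t ∈ Ioo 0 T, ∀ x ∈ Ω,
    ε • iteratedDeriv 2 (fun s => E s x) t + curl' (fun y => μ⁻¹ • curl (E t) y) x = 0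
  div : ∀ t ∈ Ioo 0 T, ∀ x ∈ Ω, divergence (fun y => ε • E t y) x = 0
  initial : ∀ x ∈ Ω, E 0 x = φ x
  initial_deriv : ∀ x ∈ Ω, derivWithin (fun s => E s x) (Icc 0 T) 0 = ψ x
  boundary : ∀ t ∈ Ioo 0 T, HasClassicalTangentialTrace Ω (E t) (f t)

/-- `u ∈ C⁰([0,T]; X(Ω)) ∩ C¹([0,T]; L²(Ω))`, where `X(Ω)` is the space of divergence free fields
in `H¹(Ω)`, is a weak solution, in the medium with constant permittivity `ε` and
permeability `μ` (a function on `Ω`), of `ε ∂_t² u + curl (μ⁻¹ curl u) = 0`, `div (ε u) = 0`, with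
initial data `φ, ψ` and with `u × n = f` on `∂Ω × (0,T)`. The wave equation is tested with the
fields of `X_N(Ω)`. -/
structure IsWeakSolution (Ω : Set (Space d)) (T ε : ℝ) (μ : Space d → ℝ)
    (φ ψ : Space d → Space d) (f : ℝ → Space d → CurlSpace d) (u : ℝ → L2 Ω (Space d)) :
    Prop where
  contDiffOn : ContDiffOn ℝ 1 u (Icc 0 T)
  memH1 : ∀ t ∈ Icc 0 T, MemH1 Ω (u t)
  continuousOn : ∀ i, ContinuousOn (fun t => weakPartial Ω i (u t)) (Icc 0 T)
  maxwell : ∀ v, MemXN Ω v → ∀ t ∈ Ioo 0 T,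
    HasDerivAt (fun s => ε * ⟪derivWithin u (Icc 0 T) s, v⟫)
      (-∫ x in Ω, (μ x)⁻¹ * ⟪weakCurl Ω (u t) x, weakCurl Ω v x⟫) t
  div : ∀ t ∈ Icc 0 T, HasWeakDiv Ω (ε • u t) 0
  initial : u 0 = toL2 Ω φ
  initial_deriv : derivWithin u (Icc 0 T) 0 = toL2 Ω ψ
  boundary : ∀ t ∈ Ioo 0 T, HasTangentialTrace Ω (u t) (f t)

/-! The inhomogeneities. -/

/-- The set `z + α B`. -/
def inclusion (α : ℝ) (z : Space d) (B : Set (Space d)) : Set (Space d) :=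
  (fun y => z + α • y) '' B

/-- The piecewise constant permeability: `μ j` in the inhomogeneity `z j + α B j` (these sets are
going to be disjoint) and `μ₀` elsewhere. -/
def permeability {m : ℕ} (μ₀ : ℝ) (μ : Fin m → ℝ) (α : ℝ) (z : Fin m → Space d)
    (B : Fin m → Set (Space d)) (x : Space d) : ℝ :=
  (⋃ j, inclusion α (z j) (B j))ᶜ.indicator (fun _ => μ₀) x +
    ∑ j, (inclusion α (z j) (B j)).indicator (fun _ => μ j) x

/-- The separation assumption on the points `z j ∈ Ω`. -/
structure IsSeparated {m : ℕ} (Ω : Set (Space d)) (c₀ : ℝ) (z : Fin m → Space d) : Prop where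
  mem : ∀ j, z j ∈ Ω
  pairwise : ∀ j l, j ≠ l → c₀ ≤ ‖z j - z l‖
  boundary : ∀ j, c₀ ≤ Metric.infDist (z j) (frontier Ω)

/-- The size `α` is so small that the inhomogeneities are disjoint and that their distance to
the complement of the closure of `Ω` is larger than `c₀ / 2`. -/
structure IsAdmissible {m : ℕ} (Ω : Set (Space d)) (c₀ α : ℝ) (z : Fin m → Space d)
    (B : Fin m → Set (Space d)) : Prop where
  pos : 0 < α
  disjoint : Pairwise fun j l => Disjoint (inclusion α (z j) (B j)) (inclusion α (z l) (B l))
  dist : ∀ j, ∀ x ∈ inclusion α (z j) (B j), c₀ / 2 < Metric.infDist x (closure Ω)ᶜ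

end

end Maxwell

open Maxwell

/-!
The difference `w = Eα - E` of the perturbed and the unperturbed field has vanishing initial values
and vanishing tangential trace, and it is divergence free. The wave equation for `E`, tested with
`v` in `X_N(Ω)`, gives by Green's formula

`ε ⟨∂ₜ² w, v⟩ + ⟨μα⁻¹ curl w, curl v⟩ = -⟨g, curl v⟩`, where `g = (μα⁻¹ - μ₀⁻¹) curl E`.

The source `g` lives on the inhomogeneities, whose volume is of order `α ^ d`. Since `curl E` and
its time derivative are bounded, `g` is in `L²` of size `O(α ^ (d / 2)) = O(α)`, and so is its
Lipschitz constant in time (`norm_contrast_le`, `exists_sqrt_volume_le`).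

The energy estimate (`energy_estimate`) is obtained by testing with `∂ₜ w`: the quantity
`ε / 2 ‖∂ₜ w‖² + 1 / 2 ⟨μα⁻¹ curl w, curl w⟩ + ⟨g, curl w⟩` has the time derivative
`⟨∂ₜ g, curl w⟩`, and looking at the time at which `‖curl w‖` is maximal one obtains bounds for
`curl w` and `∂ₜ w` in terms of `g`. Since `∂ₜ w` need not have a curl, this is done for the Steklov
averages `h⁻¹ ∫ w` over `[t, t + h]` instead of `w`. Their time derivatives are the difference
quotients of `w`, which do belong to `X_N(Ω)`; then `h` tends to zero.

Green's formula `⟨p, curl v⟩ = ⟨curl p, v⟩` for a field `v` with `v × n = 0` on the boundary is the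
divergence theorem for the field `v × p`, which is tangential to the boundary. For a tangential
field `V` the boundary integral is zero, and the theorem does not require surface measures
(`integral_divergence_eq_zero`): integrate `div V` against a cutoff function of the distance `D` to
the boundary. Where `D` is differentiable, its gradient is the unit vector which points away from
a nearest boundary point `y`, and this is a normal vector at `y`, so that `V · ∇D` is at most a
constant times `D`. Hence the term in which the cutoff function is differentiated is bounded, and
it is supported in a layer which shrinks to the boundary.
-/

namespace Maxwell

noncomputable section

variable {d : ℕ}

/-! ### Cross products as bilinear maps -/

lemma isBilinearMap_cross (d : ℕ) : IsBilinearMap ℝ (cross d) := by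
  match d with
  | 0 | 1 | _ + 4 => constructor <;> intros <;> simp [cross]
  | 2 => constructor <;> intros <;> ext i <;> fin_cases i <;> simp [cross] <;> ring
  | 3 => constructor <;> intros <;> ext i <;> fin_cases i <;> simp [cross] <;> ring

lemma isBilinearMap_cross' (d : ℕ) : IsBilinearMap ℝ (cross' d) := by
  match d with
  | 0 | 1 | _ + 4 => constructor <;> intros <;> simp [cross']
  | 2 => constructor <;> intros <;> ext i <;> fin_cases i <;> simp [cross'] <;> ring
  | 3 => constructor <;> intros <;> ext i <;> fin_cases i <;> simp [cross'] <;> ring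

/-- `cross d` as a continuous bilinear map. -/
def crossL (d : ℕ) : Space d →L[ℝ] Space d →L[ℝ] CurlSpace d :=
  (isBilinearMap_cross d).toContinuousBilinearMap

/-- `cross' d` as a continuous bilinear map. -/
def crossL' (d : ℕ) : Space d →L[ℝ] CurlSpace d →L[ℝ] Space d :=
  (isBilinearMap_cross' d).toContinuousBilinearMap

lemma crossL_apply (a b : Space d) : crossL d a b = cross d a b := rfl

lemma crossL'_apply (a : Space d) (q : CurlSpace d) : crossL' d a q = cross' d a q := rfl

lemma cross_swap (a b : Space d) : cross d a b = -cross d b a := by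
  match d with
  | 0 | 1 | _ + 4 => simp [cross]
  | 2 => ext i; fin_cases i; simp [cross]; ring
  | 3 => ext i; fin_cases i <;> simp [cross] <;> ring

lemma inner_cross' (a b : Space d) (q : CurlSpace d) :
    ⟪cross' d a q, b⟫ = -⟪q, cross d a b⟫ := by
  match d with
  | 0 | 1 | _ + 4 => simp [cross, cross']
  | 2 =>
    have key : ∀ r s : EuclideanSpace ℝ (Fin 1), inner ℝ r s = s 0 * r 0 := fun r s => by
      simp [PiLp.inner_apply]
    rw [show ⟪q, cross 2 a b⟫ = _ from key q (cross 2 a b)]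
    simp only [cross, cross', PiLp.inner_apply, Fin.sum_univ_succ]
    simp; ring
  | 3 =>
    have key : ∀ r s : EuclideanSpace ℝ (Fin 3),
        inner ℝ r s = s 0 * r 0 + s 1 * r 1 + s 2 * r 2 := fun r s => by
      simp [PiLp.inner_apply, Fin.sum_univ_three]
    rw [show ⟪q, cross 3 a b⟫ = _ from key q (cross 3 a b), key]
    simp [cross, cross']; ring

/-! ### Square integrable fields and weak derivatives -/

section WeakDerivatives

variable {Ω : Set (Space d)} {F : Type} [NormedAddCommGroup F]

lemma toL2_eq {u : Space d → F} (hu : MemLp u 2 (volume.restrict Ω)) :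
    toL2 Ω u = hu.toLp u := by
  simp [toL2, hu]

lemma coeFn_toL2 {u : Space d → F} (hu : MemLp u 2 (volume.restrict Ω)) :
    toL2 Ω u =ᵐ[volume.restrict Ω] u := by
  rw [toL2_eq hu]; exact hu.coeFn_toLp

lemma toL2_congr (hΩ : MeasurableSet Ω) {u v : Space d → F} (h : ∀ x ∈ Ω, u x = v x) :
    toL2 Ω u = toL2 Ω v := by
  have hae : u =ᵐ[volume.restrict Ω] v := (ae_restrict_mem hΩ).mono h
  by_cases hu : MemLp u 2 (volume.restrict Ω)
  · rw [toL2_eq hu, toL2_eq ((memLp_congr_ae hae).1 hu)]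
    exact (MemLp.toLp_eq_toLp_iff _ _).2 hae
  · have hv : ¬ MemLp v 2 (volume.restrict Ω) := fun h => hu ((memLp_congr_ae hae).2 h)
    simp [toL2, hu, hv]

lemma toL2_zero : toL2 Ω (0 : Space d → F) = 0 := by
  have h : MemLp (0 : Space d → F) 2 (volume.restrict Ω) := MemLp.zero
  rw [toL2_eq h]
  exact MemLp.toLp_zero h

lemma toL2_sub {u v : Space d → F} (hu : MemLp u 2 (volume.restrict Ω))
    (hv : MemLp v 2 (volume.restrict Ω)) :
    toL2 Ω (fun x => u x - v x) = toL2 Ω u - toL2 Ω v := by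
  rw [toL2_eq hu, toL2_eq hv, ← MemLp.toLp_sub]
  exact toL2_eq (hu.sub hv)

lemma toL2_const_smul [NormedSpace ℝ F] (c : ℝ) {u : Space d → F}
    (hu : MemLp u 2 (volume.restrict Ω)) :
    toL2 Ω (fun x => c • u x) = c • toL2 Ω u := by
  rw [toL2_eq hu, ← MemLp.toLp_const_smul]
  exact toL2_eq (hu.const_smul c)

/-- A field which is bounded by `C` outside of a null set and vanishes off a set of finite measure
has an `L²` norm of at most `C` times the square root of that measure. -/
lemma norm_L2_le {u : L2 Ω F} {C : ℝ} (hC : 0 ≤ C) {A : Set (Space d)} (hA : MeasurableSet A)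
    (hfin : volume A ≠ ⊤) (hb : ∀ᵐ x ∂(volume.restrict Ω), ‖u x‖ ≤ A.indicator (fun _ => C) x) :
    ‖u‖ ≤ C * √(volume.real A) := by
  have h1 : eLpNorm u 2 (volume.restrict Ω) ≤
      eLpNorm (A.indicator fun _ => C) 2 (volume.restrict Ω) := eLpNorm_mono_ae_real hb
  have h2 : eLpNorm (A.indicator fun _ => C) 2 (volume.restrict Ω) ≤
      eLpNorm (A.indicator fun _ => C) 2 volume := eLpNorm_mono_measure _ Measure.restrict_le_self
  have h3 := h1.trans h2
  rw [eLpNorm_indicator_const hA (by simp) (by simp)] at h3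
  rw [Lp.norm_def]
  refine (ENNReal.toReal_mono ?_ h3).trans_eq ?_
  · exact ENNReal.mul_ne_top (by simp) (ENNReal.rpow_ne_top_of_nonneg (by simp) hfin)
  · rw [ENNReal.toReal_mul, ← ENNReal.toReal_rpow, Real.sqrt_eq_rpow]
    simp [abs_of_nonneg hC, Measure.real]

lemma norm_toL2_le (hΩ : MeasurableSet Ω) (hfin : volume Ω ≠ ⊤) {u : Space d → F} {C : ℝ}
    (hC : 0 ≤ C) (hu : ∀ x ∈ Ω, ‖u x‖ ≤ C) :
    ‖toL2 Ω u‖ ≤ C * √(volume.real Ω) := by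
  by_cases h : MemLp u 2 (volume.restrict Ω)
  · refine norm_L2_le hC hΩ hfin ?_
    filter_upwards [coeFn_toL2 h, ae_restrict_mem hΩ] with x hx hxΩ
    rw [hx, indicator_of_mem hxΩ]
    exact hu x hxΩ
  · simp only [toL2, h, dite_false, norm_zero]
    positivity

lemma memLp_of_bound (hΩ : IsOpen Ω) (hfin : volume Ω ≠ ⊤) {u : Space d → F} {C : ℝ}
    (huc : ContinuousOn u Ω) (hu : ∀ x ∈ Ω, ‖u x‖ ≤ C) : MemLp u 2 (volume.restrict Ω) := by
  have : IsFiniteMeasure (volume.restrict Ω) := ⟨by simpa using hfin.lt_top⟩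
  exact MemLp.of_bound (huc.aestronglyMeasurable hΩ.measurableSet) C
    ((ae_restrict_mem hΩ.measurableSet).mono hu)

lemma memLp_of_continuousOn_closure (hΩ : IsOpen Ω) (hb : Bornology.IsBounded Ω)
    {u : Space d → F} (hu : ContinuousOn u (closure Ω)) : MemLp u 2 (volume.restrict Ω) := by
  obtain ⟨C, hC⟩ := hb.isCompact_closure.exists_bound_of_continuousOn hu
  exact memLp_of_bound hΩ hb.measure_lt_top.ne (hu.mono subset_closure)
    fun x hx => hC x (subset_closure hx)

/-- The product of a test function, or one of its derivatives, with a continuous field on `Ω`. -/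
lemma integrable_smul_of_tsupport_subset [NormedSpace ℝ F] (hΩ : IsOpen Ω) {θ a : Space d → ℝ}
    (hθ : IsTestFunction Ω θ) (ha : Continuous a) (hs : tsupport a ⊆ tsupport θ)
    {w : Space d → F} (hw : ContinuousOn w Ω) : Integrable (fun x => a x • w x) volume := by
  have hs2 : tsupport (fun x => a x • w x) ⊆ tsupport a := tsupport_smul_subset_left a w
  refine Continuous.integrable_of_hasCompactSupport ?_ ?_
  · refine (ha.continuousOn.smul hw).continuous_of_tsupport_subset hΩ ?_
    exact hs2.trans (hs.trans hθ.support)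
  · exact hθ.compact.of_isClosed_subset (isClosed_tsupport _) (hs2.trans hs)

lemma continuousOn_fderiv_apply [NormedSpace ℝ F] (hΩ : IsOpen Ω) {u : Space d → F}
    (hu : ContDiffOn ℝ 1 u Ω) (e : Space d) : ContinuousOn (fun x => fderiv ℝ u x e) Ω :=
  (hu.continuousOn_fderiv_of_isOpen hΩ le_rfl).clm_apply continuousOn_const

/-- Integration by parts against a test function. -/
lemma integral_test_smul_fderiv [NormedSpace ℝ F] (hΩ : IsOpen Ω) {u : Space d → F}
    (hu : ContDiffOn ℝ 1 u Ω) {θ : Space d → ℝ} (hθ : IsTestFunction Ω θ) (e : Space d) :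
    ∫ x in Ω, θ x • fderiv ℝ u x e = -∫ x in Ω, fderiv ℝ θ x e • u x := by
  have h0 : ∀ x, x ∉ Ω → θ x = 0 := fun x hx =>
    image_eq_zero_of_notMem_tsupport fun h => hx (hθ.support h)
  have h0' : ∀ x, x ∉ tsupport θ → fderiv ℝ θ x = 0 := fun x hx =>
    image_eq_zero_of_notMem_tsupport fun h => hx (tsupport_fderiv_subset ℝ h)
  have hθ1 : Continuous (fderiv ℝ θ) := hθ.smooth.continuous_fderiv (by simp)
  have hsub : tsupport (fun x => fderiv ℝ θ x e) ⊆ tsupport θ := by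
    refine closure_minimal (fun x hx => ?_) (isClosed_tsupport _)
    by_contra h
    exact hx (by simp [h0' x h])
  have hcont := fun {a : Space d → ℝ} {w : Space d → F} =>
    integrable_smul_of_tsupport_subset hΩ hθ (a := a) (w := w)
  rw [setIntegral_eq_integral_of_forall_compl_eq_zero (fun x hx => by simp [h0 x hx]),
    setIntegral_eq_integral_of_forall_compl_eq_zero
      (fun x hx => by simp [h0' x fun h => hx (hθ.support h)])]
  refine integral_smul_fderiv_eq_neg_fderiv_smul_of_integrable ?_ ?_ ?_ ?_ ?_
  · exact hcont (hθ1.clm_apply continuous_const) hsub hu.continuousOn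
  · exact hcont hθ.smooth.continuous le_rfl (continuousOn_fderiv_apply hΩ hu e)
  · exact hcont hθ.smooth.continuous le_rfl hu.continuousOn
  · exact fun x _ => (hθ.smooth.differentiable (by simp)) x
  · exact fun x hx => (hu.differentiableOn one_ne_zero).differentiableAt
      (hΩ.mem_nhds (hθ.support hx))

lemma integrable_smul_L2 [NormedSpace ℝ F] {a : Space d → ℝ} (ha : Continuous a)
    (hs : HasCompactSupport a) {w : Space d → F} (hw : MemLp w 2 (volume.restrict Ω)) :
    Integrable (fun x => a x • w x) (volume.restrict Ω) :=
  memLp_one_iff_integrable.1 (MemLp.smul hw (ha.memLp_of_hasCompactSupport hs (p := 2)))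

lemma IsTestFunction.continuous_fderiv_apply {θ : Space d → ℝ} (hθ : IsTestFunction Ω θ)
    (e : Space d) : Continuous fun x => fderiv ℝ θ x e :=
  (hθ.smooth.continuous_fderiv (by simp)).clm_apply continuous_const

lemma IsTestFunction.hasCompactSupport_fderiv_apply {θ : Space d → ℝ} (hθ : IsTestFunction Ω θ)
    (e : Space d) : HasCompactSupport fun x => fderiv ℝ θ x e :=
  hθ.compact.fderiv_apply ℝ e

lemma inner_gradient (θ : Space d → ℝ) (x v : Space d) : ⟪gradient θ x, v⟫ = fderiv ℝ θ x v := by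
  rw [gradient, InnerProductSpace.toDual_symm_apply]

lemma gradient_eq_sum (θ : Space d → ℝ) (x : Space d) :
    gradient θ x = ∑ i, fderiv ℝ θ x (EuclideanSpace.single i 1) • EuclideanSpace.single i 1 := by
  ext j
  have : (gradient θ x).ofLp j = ⟪gradient θ x, EuclideanSpace.single j 1⟫ := by
    rw [EuclideanSpace.inner_single_right]; simp
  rw [this, inner_gradient]
  simp [Finset.sum_apply, Pi.single_apply]

lemma cross_gradient (θ : Space d → ℝ) (x v : Space d) :
    cross d (gradient θ x) v = ∑ i, fderiv ℝ θ x (EuclideanSpace.single i 1) •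
      crossL d (EuclideanSpace.single i 1) v := by
  rw [← crossL_apply, gradient_eq_sum]
  simp

lemma inner_gradient_eq_sum (θ : Space d → ℝ) (x v : Space d) :
    ⟪gradient θ x, v⟫ = ∑ i, fderiv ℝ θ x (EuclideanSpace.single i 1) • v i := by
  rw [gradient_eq_sum, sum_inner]
  refine Finset.sum_congr rfl fun i _ => ?_
  rw [inner_smul_left, EuclideanSpace.inner_single_left]
  simp

/-- Integration by parts passes from the partial derivatives to the first order differential
operators `u ↦ ∑ i, ℓ i (∂_i u)` with constant coefficients. -/
lemma integral_test_smul_sum [NormedSpace ℝ F] [CompleteSpace F] {u : Space d → Space d}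
    {p : Fin d → Space d → Space d} (ℓ : Fin d → Space d →L[ℝ] F) {θ : Space d → ℝ}
    (hθ : IsTestFunction Ω θ) (hu : MemLp u 2 (volume.restrict Ω))
    (hp : ∀ i, IntegrableOn (fun x => θ x • p i x) Ω)
    (h : ∀ i, ∫ x in Ω, θ x • p i x = -∫ x in Ω, fderiv ℝ θ x (EuclideanSpace.single i 1) • u x) :
    ∫ x in Ω, θ x • ∑ i, ℓ i (p i x) =
      -∫ x in Ω, ∑ i, fderiv ℝ θ x (EuclideanSpace.single i 1) • ℓ i (u x) := by
  have hi : ∀ i, Integrable (fun x => fderiv ℝ θ x (EuclideanSpace.single i 1) • u x)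
      (volume.restrict Ω) := fun i => integrable_smul_L2 (hθ.continuous_fderiv_apply _)
        (hθ.hasCompactSupport_fderiv_apply _) hu
  simp_rw [Finset.smul_sum, ← map_smul]
  rw [integral_finsetSum _ fun i _ => (ℓ i).integrable_comp (hp i),
    integral_finsetSum _ fun i _ => (ℓ i).integrable_comp (hi i), ← Finset.sum_neg_distrib]
  refine Finset.sum_congr rfl fun i _ => ?_
  rw [ContinuousLinearMap.integral_comp_comm _ (hp i),
    ContinuousLinearMap.integral_comp_comm _ (hi i), h i, map_neg]

lemma integrableOn_test_smul_fderiv [NormedSpace ℝ F] (hΩ : IsOpen Ω) {u : Space d → F}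
    (hu : ContDiffOn ℝ 1 u Ω) {θ : Space d → ℝ} (hθ : IsTestFunction Ω θ) (e : Space d) :
    IntegrableOn (fun x => θ x • fderiv ℝ u x e) Ω :=
  (integrable_smul_of_tsupport_subset hΩ hθ hθ.smooth.continuous le_rfl
    (continuousOn_fderiv_apply hΩ hu e)).integrableOn

lemma integral_test_smul_of_ae [NormedSpace ℝ F] {θ : Space d → ℝ} {u v : Space d → F}
    (h : u =ᵐ[volume.restrict Ω] v) : ∫ x in Ω, θ x • u x = ∫ x in Ω, θ x • v x :=
  integral_congr_ae (h.mono fun x hx => by simp only [hx])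

/-- The classical curl is a weak curl. -/
lemma hasWeakCurl_toL2 (hΩ : IsOpen Ω) {u : Space d → Space d} (hu : ContDiffOn ℝ 1 u Ω)
    (hu2 : MemLp u 2 (volume.restrict Ω)) (hc : MemLp (curl u) 2 (volume.restrict Ω)) :
    HasWeakCurl Ω (toL2 Ω u) (toL2 Ω (curl u)) := by
  intro θ hθ
  rw [integral_test_smul_of_ae (coeFn_toL2 hc)]
  have h2 : ∫ x in Ω, cross d (gradient θ x) (toL2 Ω u x) =
      ∫ x in Ω, cross d (gradient θ x) (u x) :=
    integral_congr_ae ((coeFn_toL2 hu2).mono fun x hx => by simp only [hx])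
  rw [h2]
  simp_rw [cross_gradient]
  exact integral_test_smul_sum (fun i => crossL d (EuclideanSpace.single i 1)) hθ hu2
    (fun i => integrableOn_test_smul_fderiv hΩ hu hθ _)
    (fun i => integral_test_smul_fderiv hΩ hu hθ _)

/-- The classical divergence is a weak divergence. -/
lemma hasWeakDiv_toL2 (hΩ : IsOpen Ω) {u : Space d → Space d} (hu : ContDiffOn ℝ 1 u Ω)
    (hu2 : MemLp u 2 (volume.restrict Ω)) (hc : MemLp (divergence u) 2 (volume.restrict Ω)) :
    HasWeakDiv Ω (toL2 Ω u) (toL2 Ω (divergence u)) := by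
  intro θ hθ
  simp_rw [← smul_eq_mul]
  rw [integral_test_smul_of_ae (coeFn_toL2 hc)]
  have h2 : ∫ x in Ω, ⟪gradient θ x, toL2 Ω u x⟫ = ∫ x in Ω, ⟪gradient θ x, u x⟫ :=
    integral_congr_ae ((coeFn_toL2 hu2).mono fun x hx => by simp only [hx])
  rw [h2]
  simp_rw [inner_gradient_eq_sum]
  exact integral_test_smul_sum (fun i => EuclideanSpace.proj i) hθ hu2
    (fun i => integrableOn_test_smul_fderiv hΩ hu hθ _)
    (fun i => integral_test_smul_fderiv hΩ hu hθ _)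

/-- The curl of an `H¹` field in terms of its weak partial derivatives. -/
lemma hasWeakCurl_of_hasWeakPartial {u : L2 Ω (Space d)} {p : Fin d → L2 Ω (Space d)}
    (h : ∀ i, HasWeakPartial Ω i u (p i)) :
    HasWeakCurl Ω u (∑ i, (crossL d (EuclideanSpace.single i 1)).compLpL 2 _ (p i)) := by
  intro θ hθ
  have hae : (∑ i, (crossL d (EuclideanSpace.single i 1)).compLpL 2 (volume.restrict Ω) (p i) :
      L2 Ω (CurlSpace d)) =ᵐ[volume.restrict Ω]
      fun x => ∑ i, crossL d (EuclideanSpace.single i 1) (p i x) := by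
    refine (Lp.coeFn_finsetSum _ _).trans ?_
    have : ∀ᵐ x ∂(volume.restrict Ω), ∀ i,
        (crossL d (EuclideanSpace.single i 1)).compLpL 2 (volume.restrict Ω) (p i) x =
          crossL d (EuclideanSpace.single i 1) (p i x) :=
      ae_all_iff.2 fun i => ContinuousLinearMap.coeFn_compLpL _ _
    filter_upwards [this] with x hx
    simp [hx]
  rw [integral_test_smul_of_ae hae]
  simp_rw [cross_gradient]
  exact integral_test_smul_sum (fun i => crossL d (EuclideanSpace.single i 1)) hθ (Lp.memLp u)
    (fun i => integrable_smul_L2 hθ.smooth.continuous hθ.compact (Lp.memLp _))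
    (fun i => h i θ hθ)

lemma L2_eq_of_integral_test_smul [NormedSpace ℝ F] [CompleteSpace F] (hΩ : IsOpen Ω)
    {c c' : L2 Ω F}
    (h : ∀ θ, IsTestFunction Ω θ → ∫ x in Ω, θ x • c x = ∫ x in Ω, θ x • c' x) : c = c' := by
  have hl : ∀ c : L2 Ω F, LocallyIntegrable c (volume.restrict Ω) := fun c =>
    (Lp.memLp c).locallyIntegrable one_le_two
  have := hΩ.ae_eq_zero_of_integral_contDiff_smul_eq_zero (μ := volume.restrict Ω)
    (f := fun x => c x - c' x) (((hl c).sub (hl c')).locallyIntegrableOn _) ?_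
  · refine Lp.ext ?_
    filter_upwards [this, ae_restrict_mem hΩ.measurableSet] with x hx hxΩ
    exact sub_eq_zero.1 (hx hxΩ)
  · intro θ h1 h2 h3
    simp_rw [smul_sub]
    rw [integral_sub (integrable_smul_L2 h1.continuous h2 (Lp.memLp c))
      (integrable_smul_L2 h1.continuous h2 (Lp.memLp c')), h θ ⟨h1, h2, h3⟩, sub_self]

lemma HasWeakCurl.unique (hΩ : IsOpen Ω) {u : L2 Ω (Space d)} {c c' : L2 Ω (CurlSpace d)}
    (h : HasWeakCurl Ω u c) (h' : HasWeakCurl Ω u c') : c = c' :=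
  L2_eq_of_integral_test_smul hΩ fun θ hθ => (h θ hθ).trans (h' θ hθ).symm

lemma HasWeakDiv.unique (hΩ : IsOpen Ω) {u : L2 Ω (Space d)} {c c' : L2 Ω ℝ}
    (h : HasWeakDiv Ω u c) (h' : HasWeakDiv Ω u c') : c = c' :=
  L2_eq_of_integral_test_smul hΩ fun θ hθ => (h θ hθ).trans (h' θ hθ).symm

lemma HasWeakCurl.weakCurl_eq (hΩ : IsOpen Ω) {u : L2 Ω (Space d)} {c : L2 Ω (CurlSpace d)}
    (h : HasWeakCurl Ω u c) : weakCurl Ω u = c := by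
  have h' : MemHcurl Ω u := ⟨c, h⟩
  rw [weakCurl, dif_pos h']
  exact h'.choose_spec.unique hΩ h

lemma MemHcurl.hasWeakCurl {u : L2 Ω (Space d)} (h : MemHcurl Ω u) :
    HasWeakCurl Ω u (weakCurl Ω u) := by
  rw [weakCurl, dif_pos h]
  exact h.choose_spec

lemma HasWeakDiv.weakDiv_eq (hΩ : IsOpen Ω) {u : L2 Ω (Space d)} {c : L2 Ω ℝ}
    (h : HasWeakDiv Ω u c) : weakDiv Ω u = c := by
  have h' : MemHdiv Ω u := ⟨c, h⟩
  rw [weakDiv, dif_pos h']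
  exact h'.choose_spec.unique hΩ h

lemma integrable_cross_gradient {θ : Space d → ℝ} (hθ : IsTestFunction Ω θ)
    (u : L2 Ω (Space d)) :
    Integrable (fun x => cross d (gradient θ x) (u x)) (volume.restrict Ω) := by
  simp_rw [cross_gradient, ← map_smul]
  exact integrable_finsetSum _ fun i _ => ContinuousLinearMap.integrable_comp _
    (integrable_smul_L2 (hθ.continuous_fderiv_apply _) (hθ.hasCompactSupport_fderiv_apply _)
      (Lp.memLp u))

lemma integrable_inner_gradient {θ : Space d → ℝ} (hθ : IsTestFunction Ω θ)
    (u : L2 Ω (Space d)) :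
    Integrable (fun x => ⟪gradient θ x, u x⟫) (volume.restrict Ω) := by
  simp_rw [inner_gradient_eq_sum]
  exact integrable_finsetSum _ fun i _ => ContinuousLinearMap.integrable_comp
    (EuclideanSpace.proj i : Space d →L[ℝ] ℝ)
    (integrable_smul_L2 (hθ.continuous_fderiv_apply (EuclideanSpace.single i 1))
      (hθ.hasCompactSupport_fderiv_apply _) (Lp.memLp u))

lemma HasWeakCurl.sub {u v : L2 Ω (Space d)} {a b : L2 Ω (CurlSpace d)}
    (hu : HasWeakCurl Ω u a) (hv : HasWeakCurl Ω v b) : HasWeakCurl Ω (u - v) (a - b) := by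
  intro θ hθ
  rw [integral_test_smul_of_ae (Lp.coeFn_sub a b)]
  have h2 : ∫ x in Ω, cross d (gradient θ x) ((u - v : L2 Ω (Space d)) x) =
      ∫ x in Ω, (cross d (gradient θ x) (u x) - cross d (gradient θ x) (v x)) :=
    integral_congr_ae ((Lp.coeFn_sub u v).mono fun x hx => by
      simp only [hx, Pi.sub_apply, ← crossL_apply, map_sub])
  rw [h2, integral_sub (integrable_cross_gradient hθ u) (integrable_cross_gradient hθ v)]
  simp_rw [Pi.sub_apply, smul_sub]
  rw [integral_sub (integrable_smul_L2 hθ.smooth.continuous hθ.compact (Lp.memLp a))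
    (integrable_smul_L2 hθ.smooth.continuous hθ.compact (Lp.memLp b)), hu θ hθ, hv θ hθ]
  abel

lemma HasWeakDiv.sub {u v : L2 Ω (Space d)} {a b : L2 Ω ℝ}
    (hu : HasWeakDiv Ω u a) (hv : HasWeakDiv Ω v b) : HasWeakDiv Ω (u - v) (a - b) := by
  intro θ hθ
  simp_rw [← smul_eq_mul]
  rw [integral_test_smul_of_ae (Lp.coeFn_sub a b)]
  have h2 : ∫ x in Ω, ⟪gradient θ x, (u - v : L2 Ω (Space d)) x⟫ =
      ∫ x in Ω, (⟪gradient θ x, u x⟫ - ⟪gradient θ x, v x⟫) :=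
    integral_congr_ae ((Lp.coeFn_sub u v).mono fun x hx => by
      simp only [hx, Pi.sub_apply, inner_sub_right])
  rw [h2, integral_sub (integrable_inner_gradient hθ u) (integrable_inner_gradient hθ v)]
  simp_rw [Pi.sub_apply, smul_sub]
  have hu' := hu θ hθ
  have hv' := hv θ hθ
  simp_rw [← smul_eq_mul] at hu' hv'
  rw [integral_sub (integrable_smul_L2 hθ.smooth.continuous hθ.compact (Lp.memLp a))
    (integrable_smul_L2 hθ.smooth.continuous hθ.compact (Lp.memLp b)), hu', hv']
  abel

lemma HasWeakDiv.of_const_smul {c : ℝ} (hc : c ≠ 0) {u : L2 Ω (Space d)}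
    (hu : HasWeakDiv Ω (c • u) 0) : HasWeakDiv Ω u 0 := by
  intro θ hθ
  have h := hu θ hθ
  have h2 : ∫ x in Ω, ⟪gradient θ x, (c • u : L2 Ω (Space d)) x⟫ =
      ∫ x in Ω, c * ⟪gradient θ x, u x⟫ :=
    integral_congr_ae ((Lp.coeFn_smul c u).mono fun x hx => by
      simp only [hx, Pi.smul_apply, inner_smul_right])
  have h3 : ∫ x in Ω, θ x * (0 : L2 Ω ℝ) x = 0 := by
    rw [integral_congr_ae (g := fun _ => (0 : ℝ))
      ((Lp.coeFn_zero ℝ 2 (volume.restrict Ω)).mono fun x hx => by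
        simp only [hx, Pi.zero_apply, mul_zero])]
    simp
  rw [h2, integral_const_mul, h3] at h
  rw [h3]
  have := mul_eq_zero.1 (neg_eq_zero.1 h.symm)
  rw [this.resolve_left hc, neg_zero]

end WeakDerivatives

/-! ### Domains and their normals -/

open Filter Topology in
lemma eventually_lt_of_hasFDerivAt {F : Type*} [NormedAddCommGroup F] [NormedSpace ℝ F]
    {ρ : F → ℝ} {L : F →L[ℝ] ℝ} {x v : F} (h : HasFDerivAt ρ L x) (hv : L v < 0) :
    ∀ᶠ s : ℝ in 𝓝[>] 0, ρ (x + s • v) < ρ x := by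
  have h1 : Tendsto (fun t : ℝ => t⁻¹ • (ρ (x + t • v) - ρ x)) (𝓝[>] 0) (𝓝 (L v)) :=
    (h.hasLineDerivAt v).tendsto_slope_zero_right
  filter_upwards [h1.eventually (gt_mem_nhds hv), self_mem_nhdsWithin] with s hs hs0
  have hs0 : 0 < s := hs0
  rw [smul_eq_mul] at hs
  have := neg_of_mul_neg_right hs (inv_pos.2 hs0).le
  linarith

section Domain

variable {Ω : Set (Space d)}

lemma IsLocalDefiningFunction.mono {k l : WithTop ℕ∞} (hkl : l ≤ k) {x : Space d}
    {ρ : Space d → ℝ} (h : IsLocalDefiningFunction k Ω x ρ) :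
    IsLocalDefiningFunction l Ω x ρ := by
  obtain ⟨U, hU, hx, hρ, hg, hΩ⟩ := h
  exact ⟨U, hU, hx, hρ.of_le hkl, hg, hΩ⟩

lemma IsBoundedDomain.mono {k l : WithTop ℕ∞} (hkl : l ≤ k) (h : IsBoundedDomain k Ω) :
    IsBoundedDomain l Ω :=
  ⟨h.isOpen, h.isConnected, h.isBounded, fun x hx =>
    (h.boundary x hx).imp fun _ hρ => hρ.mono hkl⟩

lemma IsLocalDefiningFunction.hasFDerivAt {x : Space d} {ρ : Space d → ℝ}
    (h : IsLocalDefiningFunction 1 Ω x ρ) : HasFDerivAt ρ (fderiv ℝ ρ x) x := by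
  obtain ⟨U, hU, hx, hρ, -, -⟩ := h
  exact ((hρ.differentiableOn one_ne_zero).differentiableAt (hU.mem_nhds hx)).hasFDerivAt

open Filter Topology in
/-- From a boundary point `x` every direction in which a defining function decreases leads
into the domain. -/
lemma IsLocalDefiningFunction.eventually_mem {x : Space d} {ρ : Space d → ℝ}
    (h : IsLocalDefiningFunction 1 Ω x ρ) (hx : x ∈ frontier Ω) {v : Space d}
    (hv : fderiv ℝ ρ x v < 0) : ∀ᶠ s : ℝ in 𝓝[>] 0, x + s • v ∈ Ω := by
  have h1 := eventually_lt_of_hasFDerivAt h.hasFDerivAt hv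
  obtain ⟨U, hU, hxU, hρ, -, hΩ⟩ := h
  have hρx : ρ x ≤ 0 := by
    by_contra! hpos
    have hc : ContinuousAt ρ x := hρ.continuousOn.continuousAt (hU.mem_nhds hxU)
    have hev : ∀ᶠ y in 𝓝 x, y ∉ Ω := by
      filter_upwards [hc.eventually (lt_mem_nhds hpos), hU.mem_nhds hxU] with y hy hyU hyΩ
      exact absurd ((hΩ y hyU).1 hyΩ) (not_lt.2 hy.le)
    exact (mem_closure_iff_frequently.1 hx.1) hev
  have h2 : ∀ᶠ s : ℝ in 𝓝[>] 0, x + s • v ∈ U := by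
    have hc : Tendsto (fun s : ℝ => x + s • v) (𝓝 0) (𝓝 (x + (0 : ℝ) • v)) :=
      (Continuous.tendsto (by fun_prop) 0)
    rw [zero_smul, add_zero] at hc
    exact (hc.mono_left nhdsWithin_le_nhds).eventually (hU.mem_nhds hxU)
  filter_upwards [h1, h2] with s hs hsU
  exact (hΩ _ hsU).2 (hs.trans_le hρx)

open Filter Topology in
/-- Derivatives up to the boundary are well defined: one-sided derivatives of smooth fields on the
closure of `Ω` can be used as continuous extensions of the derivatives in `Ω`. -/
lemma IsBoundedDomain.uniqueDiffOn_closure (hΩ : IsBoundedDomain 1 Ω) :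
    UniqueDiffOn ℝ (closure Ω) := by
  intro x hx
  by_cases hxΩ : x ∈ Ω
  · exact (hΩ.isOpen.uniqueDiffWithinAt hxΩ).mono subset_closure
  have hxf : x ∈ frontier Ω := ⟨hx, fun h => hxΩ (interior_subset h)⟩
  obtain ⟨ρ, hρ⟩ := hΩ.boundary x hxf
  have hne : fderiv ℝ ρ x ≠ 0 := by
    obtain ⟨U, -, -, -, hg, -⟩ := hρ
    intro h
    exact hg (by rw [gradient, h, map_zero])
  -- The half space of directions pointing into `Ω` is open and nonempty, so it spans.
  have hsub : {v | fderiv ℝ ρ x v < 0} ⊆ tangentConeAt ℝ (closure Ω) x := by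
    intro v hv
    refine mem_tangentConeAt_of_add_smul_mem (l := 𝓝[>] (0 : ℝ)) (c := id) ?_ ?_
    · exact tendsto_id.mono_left (nhdsWithin_mono _ fun s hs => (ne_of_gt hs))
    · exact (hρ.eventually_mem hxf hv).mono fun s hs => subset_closure hs
  have hopen : IsOpen {v | fderiv ℝ ρ x v < 0} :=
    isOpen_Iio.preimage (fderiv ℝ ρ x).continuous
  obtain ⟨v, hv⟩ : ∃ v, fderiv ℝ ρ x v < 0 := by
    obtain ⟨v, hv⟩ := DFunLike.ne_iff.1 hne
    rcases lt_or_gt_of_ne hv with h | h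
    · exact ⟨v, h⟩
    · refine ⟨-v, ?_⟩
      rw [map_neg]
      exact neg_lt_zero.2 h
  refine ⟨?_, subset_closure hx⟩
  have htop : Submodule.span ℝ (tangentConeAt ℝ (closure Ω) x) = ⊤ := by
    apply Submodule.eq_top_of_nonempty_interior'
    exact ⟨v, mem_interior.2 ⟨_, hsub.trans Submodule.subset_span, hopen, hv⟩⟩
  rw [htop]
  exact dense_univ

/-- A point outside of `Ω` which is touched by a ball inside `Ω` is a boundary point. -/
lemma mem_frontier_of_ball_subset {x y : Space d} (hx : x ∈ Ω) (hy : y ∉ Ω)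
    (hball : Metric.ball x (dist x y) ⊆ Ω) : y ∈ frontier Ω := by
  have hxy : dist x y ≠ 0 := fun h => hy (dist_eq_zero.1 h ▸ hx)
  refine ⟨closure_mono hball ?_, fun h => hy (interior_subset h)⟩
  rw [closure_ball x hxy]
  exact (dist_comm y x).le

open Filter Topology in
/-- If a ball inside `Ω` touches the boundary at `y`, then its radius vector at `y` is normal
to the boundary, so that it is orthogonal to each vector which is tangential at `y`. -/
lemma inner_sub_eq_zero_of_ball_subset {x y V : Space d} (hΩ : IsBoundedDomain 1 Ω) (hx : x ∈ Ω)
    (hy : y ∉ Ω) (hball : Metric.ball x (dist x y) ⊆ Ω)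
    (hV : ∀ n, IsOutwardNormal Ω y n → ⟪V, n⟫ = 0) : ⟪V, y - x⟫ = 0 := by
  obtain ⟨ρ, hρ⟩ := hΩ.boundary y (mem_frontier_of_ball_subset hx hy hball)
  have hV' := hV _ ⟨ρ, hρ, rfl⟩
  have hder := hρ.hasFDerivAt
  obtain ⟨U, hU, hyU, -, hg, hUΩ⟩ := hρ
  set g := gradient ρ y with hgdef
  have hVg : ⟪V, g⟫ = 0 := by
    rw [inner_smul_right] at hV'
    exact (mul_eq_zero.1 hV').resolve_left (inv_ne_zero (norm_ne_zero_iff.2 hg))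
  set w := y - x with hw
  have hw0 : w ≠ 0 := sub_ne_zero.2 fun h => hy (h ▸ hx)
  -- A direction which leads into the ball does not increase `ρ`.
  have key : ∀ τ, ⟪w, τ⟫ < 0 → ⟪g, τ⟫ ≤ 0 := by
    intro τ hτ
    by_contra! hpos
    have h1 : HasFDerivAt (fun z => -ρ z) (-fderiv ℝ ρ y) y := hder.neg
    have e1 := eventually_lt_of_hasFDerivAt h1 (v := τ) (by
      rw [neg_apply, ← inner_gradient]; linarith)
    have h2 : HasFDerivAt (fun z => ‖z - x‖ ^ 2)
        (2 • (innerSL ℝ (y - x)).comp (ContinuousLinearMap.id ℝ (Space d))) y :=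
      ((hasFDerivAt_id y).sub_const x).norm_sq
    have e2 := eventually_lt_of_hasFDerivAt h2 (v := τ) (by
      rw [hw, inner_sub_left] at hτ
      simp; linarith)
    have e3 : ∀ᶠ s : ℝ in 𝓝[>] 0, y + s • τ ∈ U := by
      have hc : Tendsto (fun s : ℝ => y + s • τ) (𝓝 0) (𝓝 (y + (0 : ℝ) • τ)) :=
        (Continuous.tendsto (by fun_prop) 0)
      rw [zero_smul, add_zero] at hc
      exact (hc.mono_left nhdsWithin_le_nhds).eventually (hU.mem_nhds hyU)
    obtain ⟨s, h1, h2, h3⟩ := (e1.and (e2.and e3)).exists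
    have hmem : y + s • τ ∈ Ω := hball (by
      rw [Metric.mem_ball, dist_eq_norm, dist_comm, dist_eq_norm]
      exact lt_of_pow_lt_pow_left₀ 2 (norm_nonneg _) h2)
    have h4 := (hUΩ _ h3).1 hmem
    have h5 : ¬ ρ y < 0 := fun h => hy ((hUΩ _ hyU).2 h)
    simp only [neg_lt_neg_iff] at h1
    exact h5 (h1.trans h4)
  have key' : ∀ u, ⟪w, u⟫ = 0 → ⟪g, u⟫ ≤ 0 := by
    intro u hu
    have hlim : Tendsto (fun s : ℝ => ⟪g, u - s • w⟫) (𝓝[>] 0) (𝓝 ⟪g, u - (0 : ℝ) • w⟫) :=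
      (Continuous.tendsto (by fun_prop) 0).mono_left nhdsWithin_le_nhds
    rw [zero_smul, sub_zero] at hlim
    refine le_of_tendsto hlim ?_
    filter_upwards [self_mem_nhdsWithin] with s hs
    have hs : 0 < s := hs
    refine key _ ?_
    rw [inner_sub_right, hu, inner_smul_right, real_inner_self_eq_norm_sq]
    have := norm_pos_iff.2 hw0
    have : 0 < s * ‖w‖ ^ 2 := by positivity
    linarith
  have hw2 : ‖w‖ ^ 2 ≠ 0 := pow_ne_zero 2 (norm_ne_zero_iff.2 hw0)
  -- The component `u` of the gradient orthogonal to `w` vanishes.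
  set u := g - (⟪w, g⟫ / ‖w‖ ^ 2) • w with hu
  have hwu : ⟪w, u⟫ = 0 := by
    rw [hu, inner_sub_right, inner_smul_right, real_inner_self_eq_norm_sq]
    field_simp
    ring
  have hgu : g = u + (⟪w, g⟫ / ‖w‖ ^ 2) • w := by rw [hu]; abel
  have hu0 : u = 0 := by
    have := key' u hwu
    rw [hgu, inner_add_left, inner_smul_left, hwu, real_inner_self_eq_norm_sq] at this
    simp only [mul_zero, add_zero] at this
    exact norm_eq_zero.1 (pow_eq_zero_iff two_ne_zero |>.1 (le_antisymm this (by positivity)))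
  rw [hu0, zero_add] at hgu
  rw [hgu, inner_smul_right] at hVg
  refine (mul_eq_zero.1 hVg).resolve_left fun h => hg ?_
  rw [hgu, h, zero_smul]

open Filter Topology in
/-- The derivative of the distance to the boundary, in the direction of a field which is
tangential at the boundary, is of the order of this distance. -/
lemma abs_fderiv_infDist_le (hΩ : IsBoundedDomain 1 Ω) (hne : Ωᶜ.Nonempty) {V : Space d → Space d}
    (hVd : ContDiffOn ℝ 1 V (closure Ω)) {M : ℝ}
    (hM : ∀ x ∈ closure Ω, ‖fderivWithin ℝ V (closure Ω) x‖ ≤ M)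
    (hV : ∀ x ∈ frontier Ω, ∀ n, IsOutwardNormal Ω x n → ⟪V x, n⟫ = 0)
    {x : Space d} (hx : x ∈ Ω) (hD : DifferentiableAt ℝ (fun z => Metric.infDist z Ωᶜ) x) :
    |fderiv ℝ (fun z => Metric.infDist z Ωᶜ) x (V x)| ≤ M * Metric.infDist x Ωᶜ := by
  obtain ⟨y, hyΩ, hxy⟩ := hΩ.isOpen.isClosed_compl.exists_infDist_eq_dist hne x
  have hball : Metric.ball x (dist x y) ⊆ Ω := hxy ▸ Metric.ball_infDist_compl_subset
  have hyf := mem_frontier_of_ball_subset hx hyΩ hball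
  have horth := inner_sub_eq_zero_of_ball_subset hΩ hx hyΩ hball (hV y hyf)
  set D : Space d → ℝ := fun z => Metric.infDist z Ωᶜ with hDdef
  set w := y - x with hw
  have hwr : ‖w‖ = dist x y := by rw [hw, dist_comm, dist_eq_norm]
  have hr : 0 < dist x y := dist_pos.2 fun h => hyΩ (h ▸ hx)
  have hDx : D x = dist x y := hxy
  have hdw : fderiv ℝ D x w = -dist x y := by
    have h1 : Tendsto (fun t : ℝ => t⁻¹ • (D (x + t • w) - D x)) (𝓝[>] 0) (𝓝 (fderiv ℝ D x w)) :=
      (hD.hasFDerivAt.hasLineDerivAt w).tendsto_slope_zero_right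
    refine tendsto_nhds_unique h1 (tendsto_nhds_of_eventually_eq ?_)
    filter_upwards [Ioo_mem_nhdsGT (zero_lt_one' ℝ)] with s hs
    have e1 : D (x + s • w) ≤ (1 - s) * dist x y := by
      refine (Metric.infDist_le_dist_of_mem hyΩ).trans_eq ?_
      have : x + s • w - y = -((1 - s) • w) := by rw [hw]; module
      rw [dist_eq_norm, this, norm_neg, norm_smul, Real.norm_of_nonneg (by linarith [hs.2]), hwr]
    have e2 : D x ≤ D (x + s • w) + s * dist x y := by
      refine (Metric.infDist_le_infDist_add_dist (y := x + s • w)).trans_eq ?_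
      rw [dist_eq_norm, sub_add_cancel_left, norm_neg, norm_smul, Real.norm_of_nonneg hs.1.le, hwr]
    have e3 : D (x + s • w) - D x = s * -dist x y := by rw [hDx] at *; linarith
    rw [e3, smul_eq_mul, inv_mul_cancel_left₀ hs.1.ne']
  have hG1 : ‖gradient D x‖ ≤ 1 := by
    rw [gradient, LinearIsometryEquiv.norm_map]
    simpa using norm_fderiv_le_of_lipschitz ℝ (Metric.lipschitz_infDist_pt Ωᶜ) (x₀ := x)
  -- Equality in the Cauchy-Schwarz inequality: the gradient of the distance is `-w / ‖w‖`.
  have hG : dist x y • gradient D x = -w := by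
    rw [← sub_eq_zero, sub_neg_eq_add, ← norm_eq_zero, ← sq_eq_zero_iff]
    refine le_antisymm ?_ (by positivity)
    rw [norm_add_sq_real, inner_smul_left, inner_gradient, hdw, norm_smul, hwr,
      Real.norm_of_nonneg hr.le]
    have : ‖gradient D x‖ ^ 2 ≤ 1 := pow_le_one₀ (norm_nonneg _) hG1
    simp only [conj_trivial]
    nlinarith [sq_nonneg (dist x y)]
  -- The segment from `x` to `y` stays in the closure of `Ω`, so `V` is Lipschitz along it.
  have hLip : ‖V y - V x‖ ≤ M * ‖y - x‖ := by
    have hsub : segment ℝ x y ⊆ closure Ω := by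
      refine subset_trans ?_ (closure_mono hball)
      rw [closure_ball x hr.ne']
      exact (convex_closedBall x _).segment_subset (Metric.mem_closedBall_self hr.le)
        (dist_comm y x).le
    refine (convex_segment x y).norm_image_sub_le_of_norm_hasFDerivWithin_le
      (fun z hz => ((hVd.differentiableOn one_ne_zero z (hsub hz)).hasFDerivWithinAt).mono hsub)
      (fun z hz => hM z (hsub hz)) (left_mem_segment ℝ x y) (right_mem_segment ℝ x y)
  have h3 : dist x y * fderiv ℝ D x (V x) = ⟪w, V y - V x⟫ := by
    rw [← inner_gradient, ← real_inner_smul_left, hG, inner_neg_left, inner_sub_right,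
      real_inner_comm (V y) w, horth, zero_sub]
  have h4 : dist x y * |fderiv ℝ D x (V x)| ≤ dist x y * (M * D x) := by
    rw [← abs_of_pos hr, ← abs_mul, abs_of_pos hr, h3, hDx]
    refine (abs_real_inner_le_norm _ _).trans ?_
    rw [hwr]
    gcongr
    rw [← hwr]
    exact hLip
  exact le_of_mul_le_mul_left h4 hr

end Domain

/-! ### The divergence theorem for tangential fields -/

section Green

variable {Ω : Set (Space d)}

lemma deriv_smoothTransition_of_neg {x : ℝ} (hx : x < 0) : deriv Real.smoothTransition x = 0 := by
  have : Real.smoothTransition =ᶠ[nhds x] fun _ => 0 :=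
    (gt_mem_nhds hx).mono fun y hy => Real.smoothTransition.zero_of_nonpos (le_of_lt hy)
  rw [this.deriv_eq, deriv_const]

lemma deriv_smoothTransition_of_one_lt {x : ℝ} (hx : 1 < x) :
    deriv Real.smoothTransition x = 0 := by
  have : Real.smoothTransition =ᶠ[nhds x] fun _ => 1 :=
    (lt_mem_nhds hx).mono fun y hy => Real.smoothTransition.one_of_one_le (le_of_lt hy)
  rw [this.deriv_eq, deriv_const]

lemma exists_abs_deriv_smoothTransition_le :
    ∃ K : NNReal, ∀ x, |deriv Real.smoothTransition x| ≤ K := by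
  have hc : Continuous (deriv Real.smoothTransition) :=
    (Real.smoothTransition.contDiff (n := 1)).continuous_deriv le_rfl
  obtain ⟨K, hK⟩ := isCompact_Icc.exists_bound_of_continuousOn (s := Icc (0 : ℝ) 1) hc.continuousOn
  refine ⟨K.toNNReal, fun x => ?_⟩
  rcases lt_or_ge x 0 with h | h
  · simp [deriv_smoothTransition_of_neg h]
  rcases lt_or_ge 1 x with h' | h'
  · simp [deriv_smoothTransition_of_one_lt h']
  · exact (hK x ⟨h, h'⟩).trans (Real.le_coe_toNNReal K)

/-- A Lipschitz cutoff function: zero at distance at most `1 / r` from the complement of `Ω`, one at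
distance at least `2 / r`, and a smooth function of this distance. -/
def cutoff (Ω : Set (Space d)) (r : ℝ) (x : Space d) : ℝ :=
  Real.smoothTransition (r * Metric.infDist x Ωᶜ - 1)

lemma lipschitzWith_cutoff (Ω : Set (Space d)) (r : ℝ) : ∃ K, LipschitzWith K (cutoff Ω r) := by
  obtain ⟨K, hK⟩ := exists_abs_deriv_smoothTransition_le
  have h1 : LipschitzWith K Real.smoothTransition :=
    lipschitzWith_of_nnnorm_deriv_le
      ((Real.smoothTransition.contDiff (n := 1)).differentiable one_ne_zero)
      fun x => by rw [← NNReal.coe_le_coe]; exact hK x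
  have h2 : LipschitzWith ‖r‖₊ (fun x : ℝ => r * x) := by
    refine LipschitzWith.of_dist_le_mul fun x y => ?_
    rw [dist_eq_norm, ← mul_sub, norm_mul, dist_eq_norm]; rfl
  have h3 := h1.comp (((h2.comp (Metric.lipschitz_infDist_pt Ωᶜ))).sub (LipschitzWith.const 1))
  exact ⟨_, h3⟩

lemma norm_cutoff_le (r : ℝ) (x : Space d) : ‖cutoff Ω r x‖ ≤ 1 := by
  rw [cutoff, Real.norm_of_nonneg (Real.smoothTransition.nonneg _)]
  exact Real.smoothTransition.le_one _

lemma cutoff_eq_zero {r : ℝ} {x : Space d} (h : r * Metric.infDist x Ωᶜ ≤ 1) :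
    cutoff Ω r x = 0 := Real.smoothTransition.zero_of_nonpos (by linarith)

lemma cutoff_eq_one {r : ℝ} {x : Space d} (h : 2 ≤ r * Metric.infDist x Ωᶜ) :
    cutoff Ω r x = 1 := Real.smoothTransition.one_of_one_le (by linarith)

lemma fderiv_cutoff {r : ℝ} {x : Space d}
    (hD : DifferentiableAt ℝ (fun z => Metric.infDist z Ωᶜ) x) :
    fderiv ℝ (cutoff Ω r) x = (deriv Real.smoothTransition (r * Metric.infDist x Ωᶜ - 1) * r) •
      fderiv ℝ (fun z => Metric.infDist z Ωᶜ) x := by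
  have h1 : HasDerivAt Real.smoothTransition
      (deriv Real.smoothTransition (r * Metric.infDist x Ωᶜ - 1)) (r * Metric.infDist x Ωᶜ - 1) :=
    (((Real.smoothTransition.contDiff (n := 1)).differentiable one_ne_zero) _).hasDerivAt
  have h2 : HasFDerivAt (fun z => r * Metric.infDist z Ωᶜ - 1)
      (r • fderiv ℝ (fun z => Metric.infDist z Ωᶜ) x) x :=
    (hD.hasFDerivAt.const_mul r).sub_const 1
  have h3 : HasFDerivAt (cutoff Ω r) _ x := h1.comp_hasFDerivAt x h2
  rw [h3.fderiv, smul_smul]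

lemma isCompact_le_infDist (hb : Bornology.IsBounded Ω) {δ : ℝ} (hδ : 0 < δ) :
    IsCompact {x | δ ≤ Metric.infDist x Ωᶜ} := by
  refine Metric.isCompact_of_isClosed_isBounded
    (isClosed_le continuous_const (Metric.continuous_infDist_pt _)) (hb.subset fun x hx => ?_)
  by_contra h
  have hx : δ ≤ Metric.infDist x Ωᶜ := hx
  rw [Metric.infDist_zero_of_mem h] at hx
  linarith

lemma mem_of_infDist_compl_pos {x : Space d} (h : 0 < Metric.infDist x Ωᶜ) : x ∈ Ω := by
  by_contra h'
  rw [Metric.infDist_zero_of_mem h'] at h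
  exact lt_irrefl _ h

lemma exists_isTestFunction_eq_one (hb : Bornology.IsBounded Ω) {δ : ℝ} (hδ : 0 < δ) :
    ∃ θ, IsTestFunction Ω θ ∧ ∀ x, δ ≤ Metric.infDist x Ωᶜ → θ x = 1 := by
  have hc : Continuous fun x => Metric.infDist x Ωᶜ := Metric.continuous_infDist_pt _
  obtain ⟨θ, h1, -, h3, h4⟩ := exists_contMDiff_support_eq_eq_one_iff
    (n := (⊤ : ℕ∞)) (modelWithCornersSelf ℝ (Space d))
    (s := {x | δ / 2 < Metric.infDist x Ωᶜ}) (t := {x | δ ≤ Metric.infDist x Ωᶜ})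
    (isOpen_lt continuous_const hc) (isClosed_le continuous_const hc)
    (fun x (hx : δ ≤ _) => show δ / 2 < _ by linarith)
  have hsub : tsupport θ ⊆ {x | δ / 2 ≤ Metric.infDist x Ωᶜ} := by
    rw [tsupport, h3]
    exact closure_minimal (fun x (hx : δ / 2 < _) => show δ / 2 ≤ _ from hx.le)
      (isClosed_le continuous_const hc)
  refine ⟨θ, ⟨h1.contDiff, ?_, ?_⟩, fun x hx => (h4 x).1 hx⟩
  · exact (isCompact_le_infDist hb (half_pos hδ)).of_isClosed_subset (isClosed_tsupport _) hsub
  · refine hsub.trans fun x (hx : δ / 2 ≤ _) => mem_of_infDist_compl_pos (Ω := Ω) (by linarith)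

lemma fderiv_cutoff_eq_zero {r : ℝ} {x : Space d} (h : r * Metric.infDist x Ωᶜ < 1) :
    fderiv ℝ (cutoff Ω r) x = 0 := by
  have hc : Continuous fun x => r * Metric.infDist x Ωᶜ :=
    continuous_const.mul (Metric.continuous_infDist_pt _)
  have : cutoff Ω r =ᶠ[nhds x] fun _ => 0 :=
    (hc.continuousAt.eventually (gt_mem_nhds h)).mono fun y hy => cutoff_eq_zero (le_of_lt hy)
  rw [this.fderiv_eq, fderiv_fun_const, Pi.zero_apply]

/-- Integration by parts against the Lipschitz cutoff function. -/
lemma integral_cutoff_mul_fderiv (hΩ : IsOpen Ω) (hb : Bornology.IsBounded Ω) {r : ℝ} (hr : 0 < r)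
    {v : Space d → ℝ} (hv : ContDiffOn ℝ 1 v Ω) (e : Space d) :
    ∫ x in Ω, cutoff Ω r x * fderiv ℝ v x e = -∫ x in Ω, fderiv ℝ (cutoff Ω r) x e * v x := by
  -- The localized field `θ v` extends by zero to a `C¹` function on the whole space.
  obtain ⟨θ, hθ, hθ1⟩ := exists_isTestFunction_eq_one hb (δ := r⁻¹ / 2) (by positivity)
  obtain ⟨K, hK⟩ := lipschitzWith_cutoff Ω r
  set g : Space d → ℝ := fun x => θ x * v x with hg
  have hts : tsupport g ⊆ tsupport θ := tsupport_mul_subset_left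
  have hgc : ContDiff ℝ 1 g := by
    refine contDiff_iff_contDiffAt.2 fun x => ?_
    by_cases hx : x ∈ tsupport g
    swap
    · exact contDiffAt_const.congr_of_eventuallyEq (notMem_tsupport_iff_eventuallyEq.1 hx)
    have hxΩ := hθ.support (hts hx)
    exact (hθ.smooth.of_le (by simp)).contDiffAt.mul (hv.contDiffAt (hΩ.mem_nhds hxΩ))
  have hgs : HasCompactSupport g := hθ.compact.of_isClosed_subset (isClosed_tsupport _) hts
  obtain ⟨K', hK'⟩ := hgc.lipschitzWith_of_hasCompactSupport hgs one_ne_zero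
  have h1 := hK.integral_lineDeriv_mul_eq (μ := volume) hK' hgs e
  have hfar : ∀ x, ¬ r⁻¹ / 2 < Metric.infDist x Ωᶜ → r * Metric.infDist x Ωᶜ < 1 := by
    intro x hx
    rw [not_lt] at hx
    have := mul_le_mul_of_nonneg_left hx hr.le
    have h2 : r * (r⁻¹ / 2) = 1 / 2 := by field_simp
    linarith
  have hout : ∀ x, x ∉ Ω → r * Metric.infDist x Ωᶜ < 1 := fun x hx => by
    rw [Metric.infDist_zero_of_mem hx]; simp
  have h2 : ∫ x, lineDeriv ℝ (cutoff Ω r) x e * g x =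
      ∫ x in Ω, fderiv ℝ (cutoff Ω r) x e * v x := by
    rw [← setIntegral_eq_integral_of_forall_compl_eq_zero (s := Ω)]
    · refine integral_congr_ae (ae_restrict_of_ae ?_)
      filter_upwards [hK.ae_differentiableAt (μ := volume)] with x hx
      rw [hx.lineDeriv_eq_fderiv]
      by_cases h : r⁻¹ / 2 < Metric.infDist x Ωᶜ
      · simp only [hg, hθ1 x h.le, one_mul]
      · rw [fderiv_cutoff_eq_zero (hfar x h)]; simp
    · intro x hx
      have : g x = 0 := image_eq_zero_of_notMem_tsupport fun h => hx (hθ.support (hts h))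
      rw [this, mul_zero]
  have h3 : ∫ x, lineDeriv ℝ g x (-e) * cutoff Ω r x =
      -∫ x in Ω, cutoff Ω r x * fderiv ℝ v x e := by
    rw [← setIntegral_eq_integral_of_forall_compl_eq_zero (s := Ω), ← integral_neg]
    · congr 1
      funext x
      rw [(hgc.differentiable one_ne_zero x).lineDeriv_eq_fderiv, map_neg]
      by_cases h : r⁻¹ / 2 < Metric.infDist x Ωᶜ
      · have : g =ᶠ[nhds x] v := by
          filter_upwards [(Metric.continuous_infDist_pt Ωᶜ).continuousAt.eventually
            (lt_mem_nhds h)] with y hy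
          simp only [hg, hθ1 y (le_of_lt hy), one_mul]
        rw [this.fderiv_eq]; ring
      · rw [cutoff_eq_zero (hfar x h).le]; simp
    · intro x hx
      rw [cutoff_eq_zero (hout x hx).le, mul_zero]
  rw [h2, h3] at h1
  rw [h1, neg_neg]

lemma exists_norm_fderivWithin_le (hΩ : IsBoundedDomain 1 Ω) {F : Type*} [NormedAddCommGroup F]
    [NormedSpace ℝ F] {V : Space d → F} (hVd : ContDiffOn ℝ 1 V (closure Ω)) :
    ∃ M : ℝ, 0 ≤ M ∧ ∀ x ∈ closure Ω, ‖fderivWithin ℝ V (closure Ω) x‖ ≤ M := by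
  obtain ⟨M, hM⟩ := hΩ.isBounded.isCompact_closure.exists_bound_of_continuousOn
    (hVd.continuousOn_fderivWithin hΩ.uniqueDiffOn_closure le_rfl)
  exact ⟨max M 0, le_max_right _ _, fun x hx => (hM x hx).trans (le_max_left _ _)⟩

lemma fderivWithin_closure (hΩ : IsOpen Ω) {F : Type*} [NormedAddCommGroup F]
    [NormedSpace ℝ F] {V : Space d → F} {x : Space d} (hx : x ∈ Ω) :
    fderivWithin ℝ V (closure Ω) x = fderiv ℝ V x :=
  fderivWithin_of_mem_nhds (Filter.mem_of_superset (hΩ.mem_nhds hx) subset_closure)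

lemma norm_single_one (i : Fin d) : ‖(EuclideanSpace.single i 1 : Space d)‖ = 1 := by simp

open Filter Topology in
/-- The divergence theorem for fields which are tangential at the boundary. -/
lemma integral_divergence_eq_zero (hΩ : IsBoundedDomain 1 Ω) (hne : Ωᶜ.Nonempty)
    {V : Space d → Space d} (hVd : ContDiffOn ℝ 1 V (closure Ω))
    (hV : ∀ x ∈ frontier Ω, ∀ n, IsOutwardNormal Ω x n → ⟪V x, n⟫ = 0) :
    ∫ x in Ω, divergence V x = 0 := by
  obtain ⟨M, hM0, hM⟩ := exists_norm_fderivWithin_le hΩ hVd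
  obtain ⟨K, hK⟩ := exists_abs_deriv_smoothTransition_le
  have hopen := hΩ.isOpen
  have hfin : IsFiniteMeasure (volume.restrict Ω) :=
    ⟨by simpa using hΩ.isBounded.measure_lt_top⟩
  have hVd' : ContDiffOn ℝ 1 V Ω := hVd.mono subset_closure
  have hcont : ContinuousOn (fderiv ℝ V) Ω := hVd'.continuousOn_fderiv_of_isOpen hopen le_rfl
  have hdiv : ContinuousOn (divergence V) Ω := by
    refine continuousOn_finsetSum _ fun i _ => ?_
    exact (EuclideanSpace.proj i : Space d →L[ℝ] ℝ).continuous.comp_continuousOn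
      (hcont.clm_apply continuousOn_const)
  have hdivb : ∀ x ∈ Ω, ‖divergence V x‖ ≤ ∑ _i : Fin d, M := by
    intro x hx
    refine (norm_sum_le _ _).trans (Finset.sum_le_sum fun i _ => ?_)
    refine (PiLp.norm_apply_le _ i).trans ((ContinuousLinearMap.le_opNorm _ _).trans ?_)
    rw [norm_single_one, mul_one, ← fderivWithin_closure hopen hx]
    exact hM x (subset_closure hx)
  have hDpos : ∀ x ∈ Ω, 0 < Metric.infDist x Ωᶜ := fun x hx =>
    (hopen.isClosed_compl.notMem_iff_infDist_pos hne).1 (by simpa using hx)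
  have hI : ∀ n : ℕ, ∫ x in Ω, cutoff Ω (n + 1) x * divergence V x =
      -∫ x in Ω, ∑ i, fderiv ℝ (cutoff Ω (n + 1)) x (EuclideanSpace.single i 1) * V x i := by
    intro n
    obtain ⟨L, hL⟩ := lipschitzWith_cutoff Ω ((n : ℝ) + 1)
    obtain ⟨N, hN⟩ := hΩ.isBounded.isCompact_closure.exists_bound_of_continuousOn hVd.continuousOn
    simp_rw [divergence, Finset.mul_sum]
    rw [integral_finsetSum, integral_finsetSum, ← Finset.sum_neg_distrib]
    · refine Finset.sum_congr rfl fun i _ => ?_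
      have hvi : ContDiffOn ℝ 1 (fun x => V x i) Ω :=
        (EuclideanSpace.proj i : Space d →L[ℝ] ℝ).contDiff.comp_contDiffOn hVd'
      rw [← integral_cutoff_mul_fderiv hopen hΩ.isBounded (by positivity) hvi]
      refine setIntegral_congr_fun hopen.measurableSet fun x hx => ?_
      have hVx : HasFDerivAt V (fderiv ℝ V x) x := ((hVd'.differentiableOn
        one_ne_zero).differentiableAt (hopen.mem_nhds hx)).hasFDerivAt
      have := ((EuclideanSpace.proj i : Space d →L[ℝ] ℝ).hasFDerivAt.comp x hVx).fderiv
      change _ = cutoff Ω (n + 1) x *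
        fderiv ℝ ((EuclideanSpace.proj i : Space d →L[ℝ] ℝ) ∘ V) x (EuclideanSpace.single i 1)
      rw [this]; rfl
    · intro i _
      refine Integrable.of_bound (C := L * N) ?_ ?_
      · refine AEStronglyMeasurable.mul ?_ ?_
        · exact (measurable_fderiv_apply_const ℝ _ _).aestronglyMeasurable
        · exact ((EuclideanSpace.proj i : Space d →L[ℝ] ℝ).continuous.comp_continuousOn
            hVd'.continuousOn).aestronglyMeasurable hopen.measurableSet
      · filter_upwards [ae_restrict_mem hopen.measurableSet] with x hx
        rw [norm_mul]
        refine mul_le_mul ?_ ?_ (norm_nonneg _) L.2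
        · refine (ContinuousLinearMap.le_opNorm _ _).trans ?_
          rw [norm_single_one, mul_one]
          exact norm_fderiv_le_of_lipschitz ℝ hL
        · exact (PiLp.norm_apply_le _ i).trans (hN x (subset_closure hx))
    · intro i _
      refine Integrable.of_bound (C := 1 * M) ?_ ?_
      · refine AEStronglyMeasurable.mul hL.continuous.aestronglyMeasurable ?_
        exact ((EuclideanSpace.proj i : Space d →L[ℝ] ℝ).continuous.comp_continuousOn
          (hcont.clm_apply continuousOn_const)).aestronglyMeasurable hopen.measurableSet
      · filter_upwards [ae_restrict_mem hopen.measurableSet] with x hx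
        rw [norm_mul]
        refine mul_le_mul (norm_cutoff_le _ x) ?_ (norm_nonneg _) zero_le_one
        refine (PiLp.norm_apply_le _ i).trans ((ContinuousLinearMap.le_opNorm _ _).trans ?_)
        rw [norm_single_one, mul_one, ← fderivWithin_closure hopen hx]
        exact hM x (subset_closure hx)
  have hlarge : ∀ x ∈ Ω, ∀ᶠ n : ℕ in atTop, 2 < ((n : ℝ) + 1) * Metric.infDist x Ωᶜ := by
    intro x hx
    have : Tendsto (fun n : ℕ => ((n : ℝ) + 1) * Metric.infDist x Ωᶜ) atTop atTop :=
      (tendsto_atTop_add_const_right _ _ tendsto_natCast_atTop_atTop).atTop_mul_const (hDpos x hx)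
    exact this.eventually_gt_atTop 2
  have hlim1 : Tendsto (fun n : ℕ => ∫ x in Ω, cutoff Ω (n + 1) x * divergence V x) atTop
      (𝓝 (∫ x in Ω, divergence V x)) := by
    refine tendsto_integral_of_dominated_convergence (fun _ => ∑ _i : Fin d, M) ?_
      (integrable_const _) ?_ ?_
    · intro n
      obtain ⟨L, hL⟩ := lipschitzWith_cutoff Ω ((n : ℝ) + 1)
      exact hL.continuous.aestronglyMeasurable.mul
        (hdiv.aestronglyMeasurable hopen.measurableSet)
    · intro n
      filter_upwards [ae_restrict_mem hopen.measurableSet] with x hx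
      rw [norm_mul]
      exact (mul_le_of_le_one_left (norm_nonneg _) (norm_cutoff_le _ x)).trans
        (hdivb x hx)
    · filter_upwards [ae_restrict_mem hopen.measurableSet] with x hx
      refine tendsto_nhds_of_eventually_eq ?_
      filter_upwards [hlarge x hx] with n hn
      rw [cutoff_eq_one hn.le, one_mul]
  -- The derivative of the cutoff function is of order `n` and `V · ∇D` of order `D ≤ 2 / n` where
  -- it does not vanish, so the integrands are bounded; they vanish for large `n` at each point.
  have hlim2 : Tendsto (fun n : ℕ => ∫ x in Ω,
      ∑ i, fderiv ℝ (cutoff Ω (n + 1)) x (EuclideanSpace.single i 1) * V x i) atTop (𝓝 0) := by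
    have hsum : ∀ (n : ℕ) (x : Space d),
        ∑ i, fderiv ℝ (cutoff Ω (n + 1)) x (EuclideanSpace.single i 1) * V x i =
          fderiv ℝ (cutoff Ω (n + 1)) x (V x) := by
      intro n x
      rw [← inner_gradient, inner_gradient_eq_sum]; rfl
    have hDae := (Metric.lipschitz_infDist_pt Ωᶜ).ae_differentiableAt (μ := (volume : Measure
      (Space d)))
    have h0 : ∫ _ in Ω, (0 : ℝ) = 0 := by simp
    rw [← h0]
    refine tendsto_integral_of_dominated_convergence (fun _ => K * (2 * M)) ?_
      (integrable_const _) ?_ ?_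
    · intro n
      refine Finset.aestronglyMeasurable_fun_sum _ fun i _ => AEStronglyMeasurable.mul ?_ ?_
      · exact (measurable_fderiv_apply_const ℝ _ _).aestronglyMeasurable
      · exact ((EuclideanSpace.proj i : Space d →L[ℝ] ℝ).continuous.comp_continuousOn
          hVd'.continuousOn).aestronglyMeasurable hopen.measurableSet
    · intro n
      filter_upwards [ae_restrict_mem hopen.measurableSet, ae_restrict_of_ae hDae] with x hx hxD
      rw [hsum, fderiv_cutoff hxD]
      have hb := abs_fderiv_infDist_le hΩ hne hVd hM hV hx hxD
      rw [smul_apply, smul_eq_mul, Real.norm_eq_abs, abs_mul, abs_mul,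
        abs_of_nonneg (by positivity : (0 : ℝ) ≤ (n : ℝ) + 1)]
      rcases lt_or_ge 2 (((n : ℝ) + 1) * Metric.infDist x Ωᶜ) with h | h
      · rw [deriv_smoothTransition_of_one_lt (by linarith)]
        simp only [abs_zero, zero_mul]
        positivity
      · rw [mul_assoc]
        refine mul_le_mul (hK _) ?_ (by positivity) K.2
        calc ((n : ℝ) + 1) * |fderiv ℝ (fun z => Metric.infDist z Ωᶜ) x (V x)|
            ≤ ((n : ℝ) + 1) * (M * Metric.infDist x Ωᶜ) := by gcongr
          _ = ((n : ℝ) + 1) * Metric.infDist x Ωᶜ * M := by ring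
          _ ≤ 2 * M := by gcongr
    · filter_upwards [ae_restrict_mem hopen.measurableSet, ae_restrict_of_ae hDae] with x hx hxD
      refine tendsto_nhds_of_eventually_eq ?_
      filter_upwards [hlarge x hx] with n hn
      rw [hsum, fderiv_cutoff hxD, deriv_smoothTransition_of_one_lt (by linarith)]
      simp
  have hlim3 : Tendsto (fun n : ℕ => ∫ x in Ω, cutoff Ω (n + 1) x * divergence V x) atTop
      (𝓝 (-0)) := by
    simp_rw [hI]
    exact hlim2.neg
  rw [neg_zero] at hlim3
  exact tendsto_nhds_unique hlim1 hlim3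

end Green

/-! ### The energy estimate -/

open Filter Topology in
/-- The energy estimate for an abstract second order evolution equation, in which `p = w'`, and
where `c` is the value on `w` of a closed operator `R`: if
`ε ⟨w', v⟩' = -⟨A (R w) + g, R v⟩` for the differences `v` of values of `w`, with vanishing initial
values, then `w'` and `R w` are controlled by `g`. -/
theorem energy_estimate {H K : Type*} [NormedAddCommGroup H] [InnerProductSpace ℝ H]
    [NormedAddCommGroup K] [InnerProductSpace ℝ K] [CompleteSpace K]
    {T ε a L G : ℝ} (hT : 0 < T) (hε : 0 < ε) (ha : 0 < a) (hL : 0 ≤ L)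
    {A : K →L[ℝ] K} (hA : ∀ x y, ⟪A x, y⟫ = ⟪x, A y⟫) (hAa : ∀ x, a * ‖x‖ ^ 2 ≤ ⟪A x, x⟫)
    {w p : ℝ → H} {c g : ℝ → K}
    (hw : ∀ t ∈ Ioo 0 T, HasDerivAt w (p t) t) (hp : ContinuousOn p (Icc 0 T))
    (hc : ContinuousOn c (Icc 0 T)) (hg : ∀ s ∈ Icc 0 T, ∀ t ∈ Icc 0 T, ‖g s - g t‖ ≤ L * |s - t|)
    (hG : ∀ t ∈ Icc 0 T, ‖g t‖ ≤ G) (hp0 : p 0 = 0) (hc0 : c 0 = 0)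
    (heq : ∀ s ∈ Ioo 0 T, ∀ t ∈ Ioo 0 T, ∀ r ∈ Ioo 0 T,
      HasDerivAt (fun r => ε * ⟪p r, w t - w s⟫) (-⟪A (c r) + g r, c t - c s⟫) r)
    {t : ℝ} (ht : t ∈ Icc 0 T) :
    ‖c t‖ ≤ 2 * (G + L * T) / a ∧ ‖p t‖ ≤ 2 * (G + L * T) / √(ε * a) := by
  have hTT := hT.le
  have h0mem : (0 : ℝ) ∈ Icc 0 T := ⟨le_rfl, hTT⟩
  -- The fields `c`, `g` are extended to continuous functions on `ℝ`, with primitives `Φ`, `Γ`.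
  have hgc : ContinuousOn g (Icc 0 T) := by
    refine LipschitzOnWith.continuousOn (K := L.toNNReal)
      (LipschitzOnWith.of_dist_le_mul fun x hx y hy => ?_)
    rw [dist_eq_norm, dist_eq_norm, Real.coe_toNNReal L hL, Real.norm_eq_abs]
    exact hg x hx y hy
  set c₁ : ℝ → K := IccExtend hTT (domRestrict (Icc 0 T) c) with hc₁
  set g₁ : ℝ → K := IccExtend hTT (domRestrict (Icc 0 T) g) with hg₁
  have hc₁c : Continuous c₁ := (continuousOn_iff_continuous_domRestrict.1 hc).Icc_extend'
  have hg₁c : Continuous g₁ := (continuousOn_iff_continuous_domRestrict.1 hgc).Icc_extend'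
  have hc₁e : ∀ s ∈ Icc 0 T, c₁ s = c s := fun s hs => IccExtend_of_mem _ _ hs
  have hg₁e : ∀ s ∈ Icc 0 T, g₁ s = g s := fun s hs => IccExtend_of_mem _ _ hs
  set Φ : ℝ → K := fun s => ∫ r in (0 : ℝ)..s, c₁ r with hΦ
  set Γ : ℝ → K := fun s => ∫ r in (0 : ℝ)..s, g₁ r with hΓ
  have hΦd : ∀ s, HasDerivAt Φ (c₁ s) s := fun s => hc₁c.integral_hasStrictDerivAt 0 s |>.hasDerivAt
  have hΓd : ∀ s, HasDerivAt Γ (g₁ s) s := fun s => hg₁c.integral_hasStrictDerivAt 0 s |>.hasDerivAt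
  -- A time where `‖c‖` is maximal.
  obtain ⟨t₀, ht₀, hmax⟩ := isCompact_Icc.exists_isMaxOn ⟨0, h0mem⟩ hc.norm
  set M := ‖c t₀‖ with hM
  have hcM : ∀ s ∈ Icc 0 T, ‖c s‖ ≤ M := fun s hs => hmax hs
  have hM0 : 0 ≤ M := norm_nonneg _
  -- The weak equation, integrated in time.
  have hint : ∀ s ∈ Ioo 0 T, ∀ t ∈ Ioo 0 T,
      ε * ⟪p t - p s, w t - w s⟫ = -⟪A (Φ t - Φ s) + (Γ t - Γ s), c t - c s⟫ := by
    intro s hs t ht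
    set f : ℝ → ℝ := fun r =>
      ε * ⟪p r, w t - w s⟫ + ⟪A (Φ r) + Γ r, c t - c s⟫ with hf
    have hfd : ∀ r ∈ Ioo 0 T, HasDerivAt f 0 r := by
      intro r hr
      have h1 := heq s hs t ht r hr
      have h2 : HasDerivAt (fun r => A (Φ r) + Γ r) (A (c₁ r) + g₁ r) r :=
        (A.hasFDerivAt.comp_hasDerivAt r (hΦd r)).add (hΓd r)
      have h3 := h1.add (h2.inner ℝ (hasDerivAt_const r (c t - c s)))
      rw [hc₁e r (Ioo_subset_Icc_self hr), hg₁e r (Ioo_subset_Icc_self hr)] at h3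
      simp only [inner_zero_right, zero_add, neg_add_cancel] at h3
      exact h3
    have hconst : f t = f s := by
      refine (convex_Ioo 0 T).is_const_of_fderivWithin_eq_zero (𝕜 := ℝ)
        (fun r hr => (hfd r hr).differentiableAt.differentiableWithinAt) (fun r hr => ?_) ht hs
      rw [fderivWithin_of_isOpen isOpen_Ioo hr]
      ext
      simp [(hfd r hr).deriv]
    simp only [hf] at hconst
    rw [inner_sub_left, mul_sub]
    have h4 : ⟪A (Φ t - Φ s) + (Γ t - Γ s), c t - c s⟫ =
        ⟪A (Φ t) + Γ t, c t - c s⟫ - ⟪A (Φ s) + Γ s, c t - c s⟫ := by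
      rw [← inner_sub_left]
      congr 1
      rw [map_sub]; abel
    rw [h4]; linarith
  -- The energies. The Steklov averages of `p`, `c`, `g` over `[t, t + h]` are the difference
  -- quotients of `w`, `Φ`, `Γ`, and their time derivatives are those of `p`, `c`, `g`.
  set e : ℝ → ℝ → ℝ := fun h t => ε / 2 * ‖h⁻¹ • (w (t + h) - w t)‖ ^ 2 +
    1 / 2 * ⟪A (h⁻¹ • (Φ (t + h) - Φ t)), h⁻¹ • (Φ (t + h) - Φ t)⟫ +
    ⟪h⁻¹ • (Γ (t + h) - Γ t), h⁻¹ • (Φ (t + h) - Φ t)⟫ with he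
  set e₀ : ℝ → ℝ := fun t => ε / 2 * ‖p t‖ ^ 2 + 1 / 2 * ⟪A (c t), c t⟫ + ⟪g t, c t⟫ with he₀
  have hΦM : ∀ h > 0, ∀ s ∈ Ioo 0 T, s + h ∈ Ioo 0 T → ‖h⁻¹ • (Φ (s + h) - Φ s)‖ ≤ M := by
    intro h hh s hs hsh
    have h1 : ‖Φ (s + h) - Φ s‖ ≤ M * |s + h - s| := by
      rw [hΦ]
      simp only
      rw [intervalIntegral.integral_interval_sub_left (hc₁c.intervalIntegrable _ _)
        (hc₁c.intervalIntegrable _ _)]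
      refine intervalIntegral.norm_integral_le_of_norm_le_const fun r hr => ?_
      rw [uIoc_of_le (by linarith)] at hr
      have hr' : r ∈ Icc 0 T := ⟨by linarith [hs.1, hr.1], by linarith [hsh.2, hr.2]⟩
      rw [hc₁e r hr']
      exact hcM r hr'
    rw [add_sub_cancel_left, abs_of_pos hh] at h1
    rw [norm_smul, norm_inv, Real.norm_of_nonneg hh.le, inv_mul_le_iff₀ hh]
    linarith
  have hed : ∀ h > 0, ∀ s ∈ Ioo 0 T, s + h ∈ Ioo 0 T →
      HasDerivAt (e h) (⟪h⁻¹ • (g (s + h) - g s), h⁻¹ • (Φ (s + h) - Φ s)⟫) s := by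
    intro h hh s hs hsh
    have hW : HasDerivAt (fun s => h⁻¹ • (w (s + h) - w s)) (h⁻¹ • (p (s + h) - p s)) s :=
      (((hw _ hsh).comp_add_const s h).sub (hw _ hs)).const_smul h⁻¹
    have hC : HasDerivAt (fun s => h⁻¹ • (Φ (s + h) - Φ s)) (h⁻¹ • (c (s + h) - c s)) s := by
      have := (((hΦd (s + h)).comp_add_const s h).sub (hΦd s)).const_smul h⁻¹
      rwa [hc₁e _ (Ioo_subset_Icc_self hs), hc₁e _ (Ioo_subset_Icc_self hsh)] at this
    have hΓ' : HasDerivAt (fun s => h⁻¹ • (Γ (s + h) - Γ s)) (h⁻¹ • (g (s + h) - g s)) s := by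
      have := (((hΓd (s + h)).comp_add_const s h).sub (hΓd s)).const_smul h⁻¹
      rwa [hg₁e _ (Ioo_subset_Icc_self hs), hg₁e _ (Ioo_subset_Icc_self hsh)] at this
    have h1 := (hW.norm_sq.const_mul (ε / 2)).add
      (((A.hasFDerivAt.comp_hasDerivAt s hC).inner ℝ hC).const_mul (1 / 2)) |>.add
      (hΓ'.inner ℝ hC)
    refine h1.congr_deriv ?_
    have h2 := hint s hs (s + h) hsh
    simp only [Function.comp_apply]
    rw [hA (h⁻¹ • (c (s + h) - c s)), real_inner_comm (A _) (h⁻¹ • (c (s + h) - c s))]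
    have h3 : ε * ⟪h⁻¹ • (w (s + h) - w s), h⁻¹ • (p (s + h) - p s)⟫ =
        -⟪A (h⁻¹ • (Φ (s + h) - Φ s)), h⁻¹ • (c (s + h) - c s)⟫ -
          ⟪h⁻¹ • (Γ (s + h) - Γ s), h⁻¹ • (c (s + h) - c s)⟫ := by
      rw [real_inner_comm]
      rw [inner_add_left] at h2
      simp only [map_smul, inner_smul_left, inner_smul_right, conj_trivial]
      linear_combination h⁻¹ * h⁻¹ * h2
    linear_combination h3
  have hmono : ∀ h > 0, ∀ s ∈ Ioo 0 T, ∀ t ∈ Ioo 0 T, s ≤ t → t + h ∈ Ioo 0 T →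
      e h t - e h s ≤ L * M * T := by
    intro h hh s hs t ht hst hth
    have hmem : ∀ r ∈ Icc s t, r ∈ Ioo 0 T ∧ r + h ∈ Ioo 0 T := fun r hr =>
      ⟨⟨by linarith [hs.1, hr.1], by linarith [ht.2, hr.2]⟩,
        by linarith [hs.1, hr.1], by linarith [hth.2, hr.2]⟩
    have h1 := (convex_Icc s t).norm_image_sub_le_of_norm_hasDerivWithin_le (f := e h)
      (C := L * M) (fun r hr => (hed h hh r (hmem r hr).1 (hmem r hr).2).hasDerivWithinAt)
      (fun r hr => ?_) (left_mem_Icc.2 hst) (right_mem_Icc.2 hst)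
    · refine (le_abs_self _).trans (h1.trans ?_)
      have : ‖t - s‖ ≤ T := by
        rw [Real.norm_of_nonneg (by linarith)]; linarith [ht.2, hs.1]
      gcongr
    · obtain ⟨h2, h3⟩ := hmem r hr
      refine (norm_inner_le_norm _ _).trans
        (mul_le_mul ?_ (hΦM h hh r h2 h3) (norm_nonneg _) hL)
      have h4 := hg (r + h) (Ioo_subset_Icc_self h3) r (Ioo_subset_Icc_self h2)
      rw [add_sub_cancel_left, abs_of_pos hh] at h4
      rw [norm_smul, norm_inv, Real.norm_of_nonneg hh.le, inv_mul_le_iff₀ hh]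
      linarith
  have hlim : ∀ s ∈ Ioo 0 T, Tendsto (fun h => e h s) (𝓝[>] 0) (𝓝 (e₀ s)) := by
    intro s hs
    have h1 := (hw s hs).tendsto_slope_zero_right
    have h2 := (hΦd s).tendsto_slope_zero_right
    have h3 := (hΓd s).tendsto_slope_zero_right
    rw [hc₁e s (Ioo_subset_Icc_self hs)] at h2
    rw [hg₁e s (Ioo_subset_Icc_self hs)] at h3
    exact (((h1.norm.pow 2).const_mul (ε / 2)).add
      ((((A.continuous.tendsto _).comp h2).inner h2).const_mul (1 / 2))).add (h3.inner h2)
  have hmono₀ : ∀ s ∈ Ioo 0 T, ∀ t ∈ Ioo 0 T, s ≤ t → e₀ t - e₀ s ≤ L * M * T := by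
    intro s hs t ht hst
    refine le_of_tendsto ((hlim t ht).sub (hlim s hs)) ?_
    filter_upwards [Ioo_mem_nhdsGT (sub_pos.2 ht.2)] with h hh
    exact hmono h hh.1 s hs t ht hst ⟨by linarith [hh.1, ht.1], by linarith [hh.2]⟩
  have he₀c : ContinuousOn e₀ (Icc 0 T) :=
    ((continuousOn_const.mul (hp.norm.pow 2)).add (continuousOn_const.mul
      ((A.continuous.comp_continuousOn hc).inner hc))).add (hgc.inner hc)
  have he₀0 : e₀ 0 = 0 := by simp [he₀, hp0, hc0]
  have hbound : ∀ t ∈ Ioo 0 T, e₀ t ≤ L * M * T := by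
    intro t ht
    have h1 : Tendsto (fun s => e₀ t - e₀ s) (𝓝[Ioo 0 T] 0) (𝓝 (e₀ t - e₀ 0)) :=
      tendsto_const_nhds.sub ((he₀c 0 h0mem).mono Ioo_subset_Icc_self)
    rw [he₀0, sub_zero] at h1
    have hne : (𝓝[Ioo 0 T] (0 : ℝ)).NeBot := by
      rw [nhdsWithin_Ioo_eq_nhdsGT hT]; infer_instance
    refine le_of_tendsto h1 ?_
    rw [nhdsWithin_Ioo_eq_nhdsGT hT]
    filter_upwards [Ioo_mem_nhdsGT ht.1] with s hs
    exact hmono₀ s ⟨hs.1, hs.2.trans ht.2⟩ t ht hs.2.le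
  have hbound' : ∀ t ∈ Icc 0 T, e₀ t ≤ L * M * T := by
    have hcl : closure (Ioo 0 T) = Icc 0 T := closure_Ioo hT.ne
    exact fun t ht => ContinuousWithinAt.closure_le (hcl.symm ▸ ht)
      ((he₀c t ht).mono Ioo_subset_Icc_self) continuousWithinAt_const hbound
  have hcoer : ∀ t ∈ Icc 0 T, ε / 2 * ‖p t‖ ^ 2 + a / 2 * ‖c t‖ ^ 2 ≤ (G + L * T) * M := by
    intro t ht
    have h1 := hbound' t ht
    have h2 := hAa (c t)
    have h3 : -(G * M) ≤ ⟪g t, c t⟫ := by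
      have h4 := (abs_real_inner_le_norm (g t) (c t)).trans
        (mul_le_mul (hG t ht) (hcM t ht) (norm_nonneg _) ((norm_nonneg _).trans (hG t ht)))
      exact (abs_le.1 h4).1
    simp only [he₀] at h1
    linarith
  have hG0 : 0 ≤ G := (norm_nonneg _).trans (hG 0 h0mem)
  set κ := G + L * T with hκ
  have hκ0 : 0 ≤ κ := by positivity
  have hMκ : M ≤ 2 * κ / a := by
    have h1 := hcoer t₀ ht₀
    rw [← hM] at h1
    have h2 : 0 ≤ ε / 2 * ‖p t₀‖ ^ 2 := by positivity
    rw [le_div_iff₀ ha]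
    rcases hM0.eq_or_lt with h | h
    · rw [← h]; simpa using hκ0
    · have : M * (a / 2 * M) ≤ M * κ := by linarith
      linarith [le_of_mul_le_mul_left this h]
  refine ⟨(hcM t ht).trans hMκ, ?_⟩
  have h1 := hcoer t ht
  have h2 : 0 ≤ a / 2 * ‖c t‖ ^ 2 := by positivity
  have h3 : ε / 2 * ‖p t‖ ^ 2 ≤ κ * (2 * κ / a) :=
    (by linarith : ε / 2 * ‖p t‖ ^ 2 ≤ κ * M).trans (by gcongr)
  have h4 : 0 < √(ε * a) := Real.sqrt_pos.2 (by positivity)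
  refine le_of_sq_le_sq ?_ (by positivity)
  rw [div_pow, Real.sq_sqrt (by positivity), le_div_iff₀ (by positivity)]
  have h5 : κ * (2 * κ / a) * (2 * a) = (2 * κ) ^ 2 := by field_simp
  calc ‖p t‖ ^ 2 * (ε * a) = ε / 2 * ‖p t‖ ^ 2 * (2 * a) := by ring
    _ ≤ κ * (2 * κ / a) * (2 * a) := by gcongr
    _ = (2 * κ) ^ 2 := h5

/-! ### Green's formula for the curl -/

section CurlGreen

variable {Ω : Set (Space d)}

/-- The product rule `div (v × p) = p · curl v - curl p · v`. -/
lemma divergence_cross' {v : Space d → Space d} {p : Space d → CurlSpace d} {x : Space d}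
    (hv : DifferentiableAt ℝ v x) (hp : DifferentiableAt ℝ p x) :
    divergence (fun y => cross' d (v y) (p y)) x = ⟪p x, curl v x⟫ - ⟪curl' p x, v x⟫ := by
  have h := (crossL' d).hasFDerivAt_of_bilinear hv.hasFDerivAt hp.hasFDerivAt
  have h' : fderiv ℝ (fun y => cross' d (v y) (p y)) x = _ := h.fderiv
  rw [divergence, curl, curl', inner_sum, sum_inner, ← Finset.sum_sub_distrib]
  refine Finset.sum_congr rfl fun i _ => ?_
  have hc : ∀ y : Space d, y i = ⟪y, EuclideanSpace.single i 1⟫ := fun y => by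
    rw [EuclideanSpace.inner_single_right]; simp
  have hd : fderiv ℝ (fun y => cross' d (v y) (p y)) x (EuclideanSpace.single i 1) =
      cross' d (v x) (fderiv ℝ p x (EuclideanSpace.single i 1)) +
        cross' d (fderiv ℝ v x (EuclideanSpace.single i 1)) (p x) := by
    rw [h']; rfl
  rw [hd, hc, inner_add_left, inner_cross', inner_cross', inner_cross',
    cross_swap _ (EuclideanSpace.single i 1), inner_neg_right,
    cross_swap _ (EuclideanSpace.single i 1), inner_neg_right]
  ring

lemma contDiffOn_cross' {s : Set (Space d)} {v : Space d → Space d} {p : Space d → CurlSpace d}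
    (hv : ContDiffOn ℝ 1 v s) (hp : ContDiffOn ℝ 1 p s) :
    ContDiffOn ℝ 1 (fun y => cross' d (v y) (p y)) s :=
  ((crossL' d).contDiff.comp_contDiffOn hv).clm_apply hp

/-- The curl of a `C¹` field extends continuously to the closure of `Ω`. -/
lemma exists_curl_eqOn (hΩ : IsBoundedDomain 1 Ω) {v : Space d → Space d}
    (hv : ContDiffOn ℝ 1 v (closure Ω)) :
    ∃ c, ContinuousOn c (closure Ω) ∧ ∀ x ∈ Ω, curl v x = c x := by
  refine ⟨fun x => ∑ i, crossL d (EuclideanSpace.single i 1)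
    (fderivWithin ℝ v (closure Ω) x (EuclideanSpace.single i 1)), ?_, fun x hx => ?_⟩
  · refine continuousOn_finsetSum _ fun i _ => ?_
    exact (crossL d _).continuous.comp_continuousOn
      ((hv.continuousOn_fderivWithin hΩ.uniqueDiffOn_closure le_rfl).clm_apply continuousOn_const)
  · simp only [fderivWithin_closure hΩ.isOpen hx]; rfl

lemma exists_curl'_eqOn (hΩ : IsBoundedDomain 1 Ω) {p : Space d → CurlSpace d}
    (hp : ContDiffOn ℝ 1 p (closure Ω)) :
    ∃ c, ContinuousOn c (closure Ω) ∧ ∀ x ∈ Ω, curl' p x = c x := by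
  refine ⟨fun x => ∑ i, crossL' d (EuclideanSpace.single i 1)
    (fderivWithin ℝ p (closure Ω) x (EuclideanSpace.single i 1)), ?_, fun x hx => ?_⟩
  · refine continuousOn_finsetSum _ fun i _ => ?_
    exact (crossL' d _).continuous.comp_continuousOn
      ((hp.continuousOn_fderivWithin hΩ.uniqueDiffOn_closure le_rfl).clm_apply continuousOn_const)
  · simp only [fderivWithin_closure hΩ.isOpen hx]; rfl

lemma memLp_of_eqOn {F : Type} [NormedAddCommGroup F] {k : WithTop ℕ∞} (hΩ : IsBoundedDomain k Ω)
    {u c : Space d → F} (hc : ContinuousOn c (closure Ω)) (h : ∀ x ∈ Ω, u x = c x) :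
    MemLp u 2 (volume.restrict Ω) :=
  (memLp_congr_ae ((ae_restrict_mem hΩ.isOpen.measurableSet).mono h)).2
    (memLp_of_continuousOn_closure hΩ.isOpen hΩ.isBounded hc)

lemma memLp_curl (hΩ : IsBoundedDomain 1 Ω) {v : Space d → Space d}
    (hv : ContDiffOn ℝ 1 v (closure Ω)) : MemLp (curl v) 2 (volume.restrict Ω) := by
  obtain ⟨c, hc, h⟩ := exists_curl_eqOn hΩ hv
  exact memLp_of_eqOn hΩ hc h

lemma memLp_curl' (hΩ : IsBoundedDomain 1 Ω) {p : Space d → CurlSpace d}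
    (hp : ContDiffOn ℝ 1 p (closure Ω)) : MemLp (curl' p) 2 (volume.restrict Ω) := by
  obtain ⟨c, hc, h⟩ := exists_curl'_eqOn hΩ hp
  exact memLp_of_eqOn hΩ hc h

lemma integrable_inner_of_memLp {F : Type} [NormedAddCommGroup F] [InnerProductSpace ℝ F]
    {u v : Space d → F} (hu : MemLp u 2 (volume.restrict Ω))
    (hv : MemLp v 2 (volume.restrict Ω)) :
    Integrable (fun x => ⟪u x, v x⟫) (volume.restrict Ω) := by
  refine (L2.integrable_inner (𝕜 := ℝ) (toL2 Ω u) (toL2 Ω v)).congr ?_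
  filter_upwards [coeFn_toL2 hu, coeFn_toL2 hv] with x h1 h2
  rw [h1, h2]

lemma inner_toL2 {F : Type} [NormedAddCommGroup F] [InnerProductSpace ℝ F] {u v : Space d → F}
    (hu : MemLp u 2 (volume.restrict Ω)) (hv : MemLp v 2 (volume.restrict Ω)) :
    ⟪toL2 Ω u, toL2 Ω v⟫ = ∫ x in Ω, ⟪u x, v x⟫ := by
  rw [L2.inner_def]
  refine integral_congr_ae ?_
  filter_upwards [coeFn_toL2 hu, coeFn_toL2 hv] with x h1 h2
  rw [h1, h2]

/-- Green's formula for fields of class `C¹` up to the boundary, one of which has no tangential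
component at the boundary. -/
lemma inner_toL2_curl (hΩ : IsBoundedDomain 1 Ω) (hne : Ωᶜ.Nonempty) {v : Space d → Space d}
    {p : Space d → CurlSpace d} (hv : ContDiffOn ℝ 1 v (closure Ω))
    (hp : ContDiffOn ℝ 1 p (closure Ω)) (htr : HasClassicalTangentialTrace Ω v 0) :
    ⟪toL2 Ω p, toL2 Ω (curl v)⟫ = ⟪toL2 Ω (curl' p), toL2 Ω v⟫ := by
  have hv2 := memLp_of_continuousOn_closure hΩ.isOpen hΩ.isBounded hv.continuousOn
  have hp2 := memLp_of_continuousOn_closure hΩ.isOpen hΩ.isBounded hp.continuousOn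
  have hcv := memLp_curl hΩ hv
  have hcp := memLp_curl' hΩ hp
  have h := integral_divergence_eq_zero hΩ hne (contDiffOn_cross' hv hp) fun x hx n hn => by
    rw [inner_cross', htr x hx n hn]; simp
  have h2 : ∫ x in Ω, divergence (fun y => cross' d (v y) (p y)) x =
      ∫ x in Ω, (⟪p x, curl v x⟫ - ⟪curl' p x, v x⟫) := by
    refine setIntegral_congr_fun hΩ.isOpen.measurableSet fun x hx => ?_
    have hn := Filter.mem_of_superset (hΩ.isOpen.mem_nhds hx) subset_closure
    exact divergence_cross' ((hv.differentiableOn one_ne_zero).differentiableAt hn)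
      ((hp.differentiableOn one_ne_zero).differentiableAt hn)
  rw [h2, integral_sub (integrable_inner_of_memLp hp2 hcv) (integrable_inner_of_memLp hcp hv2),
    ← inner_toL2 hp2 hcv, ← inner_toL2 hcp hv2] at h
  linarith

/-- Green's formula for fields in `H₀(curl; Ω)`. -/
lemma HasTangentialTrace.inner_weakCurl (hΩ : IsBoundedDomain 1 Ω) (hne : Ωᶜ.Nonempty)
    {u : L2 Ω (Space d)} (hu : HasTangentialTrace Ω u 0) {p : Space d → CurlSpace d}
    (hp : ContDiffOn ℝ 1 p (closure Ω)) :
    ⟪toL2 Ω p, weakCurl Ω u⟫ = ⟪toL2 Ω (curl' p), u⟫ := by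
  rw [← sub_eq_zero, ← abs_nonpos_iff]
  set N := ‖toL2 Ω p‖ + ‖toL2 Ω (curl' p)‖ with hN
  have hN0 : 0 ≤ N := by positivity
  refine le_of_forall_pos_le_add fun η hη => ?_
  obtain ⟨v, hv, htr, h1, h2⟩ := hu.2 (η / (N + 1)) (by positivity)
  have h3 := inner_toL2_curl hΩ hne hv hp htr
  have h4 : ⟪toL2 Ω p, weakCurl Ω u⟫ - ⟪toL2 Ω (curl' p), u⟫ =
      ⟪toL2 Ω p, weakCurl Ω u - toL2 Ω (curl v)⟫ - ⟪toL2 Ω (curl' p), u - toL2 Ω v⟫ := by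
    rw [inner_sub_right, inner_sub_right, h3]; ring
  rw [h4, zero_add]
  calc _ ≤ |⟪toL2 Ω p, weakCurl Ω u - toL2 Ω (curl v)⟫| + |⟪toL2 Ω (curl' p), u - toL2 Ω v⟫| :=
        abs_sub _ _
    _ ≤ ‖toL2 Ω p‖ * (η / (N + 1)) + ‖toL2 Ω (curl' p)‖ * (η / (N + 1)) :=
        add_le_add ((abs_real_inner_le_norm _ _).trans (by gcongr))
          ((abs_real_inner_le_norm _ _).trans (by gcongr))
    _ = N / (N + 1) * η := by rw [hN]; ring
    _ ≤ 1 * η := by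
        gcongr
        rw [div_le_one (by positivity)]
        linarith
    _ = η := one_mul η

end CurlGreen

/-! ### Smooth time-dependent fields -/

section TimeDependent

variable {Ω : Set (Space d)} {T : ℝ} {F : Type} [NormedAddCommGroup F] [NormedSpace ℝ F]

/-- The closed space-time cylinder `[0,T] × closure Ω`. -/
abbrev cylinder (Ω : Set (Space d)) (T : ℝ) : Set (ℝ × Space d) := Icc 0 T ×ˢ closure Ω

/-- The time derivative of a field on the closed cylinder. -/
def timeDeriv (Ω : Set (Space d)) (T : ℝ) (G : ℝ × Space d → F) (p : ℝ × Space d) : F :=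
  fderivWithin ℝ G (cylinder Ω T) p (1, 0)

/-- The spatial curl of a field on the closed cylinder. -/
def cylinderCurl (Ω : Set (Space d)) (T : ℝ) (G : ℝ × Space d → Space d) (p : ℝ × Space d) :
    CurlSpace d :=
  ∑ i, crossL d (EuclideanSpace.single i 1)
    (fderivWithin ℝ G (cylinder Ω T) p (0, EuclideanSpace.single i 1))

lemma uniqueDiffOn_cylinder (hΩ : IsBoundedDomain 1 Ω) (hT : 0 < T) :
    UniqueDiffOn ℝ (cylinder Ω T) :=
  (uniqueDiffOn_Icc hT).prod hΩ.uniqueDiffOn_closure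

lemma contDiffOn_timeDeriv (hΩ : IsBoundedDomain 1 Ω) (hT : 0 < T) {G : ℝ × Space d → F}
    (hG : ContDiffOn ℝ ∞ G (cylinder Ω T)) :
    ContDiffOn ℝ ∞ (timeDeriv Ω T G) (cylinder Ω T) :=
  (hG.fderivWithin (uniqueDiffOn_cylinder hΩ hT) (m := ∞) (by simp)).clm_apply contDiffOn_const

lemma contDiffOn_cylinderCurl (hΩ : IsBoundedDomain 1 Ω) (hT : 0 < T) {G : ℝ × Space d → Space d}
    (hG : ContDiffOn ℝ ∞ G (cylinder Ω T)) :
    ContDiffOn ℝ ∞ (cylinderCurl Ω T G) (cylinder Ω T) :=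
  ContDiffOn.sum fun _ _ => (crossL d _).contDiff.comp_contDiffOn
    ((hG.fderivWithin (uniqueDiffOn_cylinder hΩ hT) (m := ∞) (by simp)).clm_apply
      contDiffOn_const)

lemma contDiffOn_slice {G : ℝ × Space d → F} (hG : ContDiffOn ℝ ∞ G (cylinder Ω T)) {t : ℝ}
    (ht : t ∈ Icc 0 T) : ContDiffOn ℝ ∞ (fun x => G (t, x)) (closure Ω) :=
  hG.comp (contDiff_prodMk_right t).contDiffOn fun _ hx => ⟨ht, hx⟩

lemma hasDerivWithinAt_timeDeriv {G : ℝ × Space d → F} (hG : ContDiffOn ℝ ∞ G (cylinder Ω T))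
    {t : ℝ} (ht : t ∈ Icc 0 T) {x : Space d} (hx : x ∈ closure Ω) :
    HasDerivWithinAt (fun s => G (s, x)) (timeDeriv Ω T G (t, x)) (Icc 0 T) t := by
  have h1 := (hG.differentiableOn (by simp) (t, x) ⟨ht, hx⟩).hasFDerivWithinAt
  have h2 : HasDerivWithinAt (fun s : ℝ => (s, x)) ((1 : ℝ), (0 : Space d)) (Icc 0 T) t :=
    ((hasDerivAt_id t).prodMk (hasDerivAt_const t x)).hasDerivWithinAt
  exact h1.comp_hasDerivWithinAt t h2
    (show MapsTo (fun s : ℝ => (s, x)) (Icc 0 T) (cylinder Ω T) from fun s hs => ⟨hs, hx⟩)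

lemma curl_eq_cylinderCurl (hΩ : IsOpen Ω) {G : ℝ × Space d → Space d}
    (hG : ContDiffOn ℝ ∞ G (cylinder Ω T)) {t : ℝ} (ht : t ∈ Icc 0 T) {x : Space d} (hx : x ∈ Ω) :
    curl (fun y => G (t, y)) x = cylinderCurl Ω T G (t, x) := by
  have hx' := subset_closure hx
  have h1 := (hG.differentiableOn (by simp) (t, x) ⟨ht, hx'⟩).hasFDerivWithinAt
  have h2 : HasFDerivWithinAt (fun y : Space d => (t, y)) (ContinuousLinearMap.inr ℝ ℝ (Space d))
      (closure Ω) x := (hasFDerivAt_prodMk_right t x).hasFDerivWithinAt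
  have h3 := (h1.comp x h2 fun y hy => ⟨ht, hy⟩).hasFDerivAt
    (Filter.mem_of_superset (hΩ.mem_nhds hx) subset_closure)
  have h4 : fderiv ℝ (fun y => G (t, y)) x = _ := h3.fderiv
  rw [curl, h4]
  rfl

lemma exists_norm_le_cylinder (hb : Bornology.IsBounded Ω) {G : ℝ × Space d → F}
    (hG : ContDiffOn ℝ ∞ G (cylinder Ω T)) :
    ∃ C, 0 ≤ C ∧ ∀ t ∈ Icc 0 T, ∀ x ∈ closure Ω, ‖G (t, x)‖ ≤ C := by
  obtain ⟨C, hC⟩ := (isCompact_Icc.prod hb.isCompact_closure).exists_bound_of_continuousOn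
    hG.continuousOn
  exact ⟨max C 0, le_max_right _ _, fun t ht x hx => (hC (t, x) ⟨ht, hx⟩).trans (le_max_left _ _)⟩

lemma exists_lipschitz_time (hΩ : IsBoundedDomain 1 Ω) (hT : 0 < T) {G : ℝ × Space d → F}
    (hG : ContDiffOn ℝ ∞ G (cylinder Ω T)) :
    ∃ C, 0 ≤ C ∧ ∀ s ∈ Icc 0 T, ∀ t ∈ Icc 0 T, ∀ x ∈ closure Ω,
      ‖G (s, x) - G (t, x)‖ ≤ C * |s - t| := by
  obtain ⟨C, hC0, hC⟩ := exists_norm_le_cylinder hΩ.isBounded (contDiffOn_timeDeriv hΩ hT hG)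
  refine ⟨C, hC0, fun s hs t ht x hx => ?_⟩
  exact (convex_Icc 0 T).norm_image_sub_le_of_norm_hasDerivWithin_le
    (fun r hr => hasDerivWithinAt_timeDeriv hG hr hx) (fun r hr => hC r hr x hx) ht hs

lemma memLp_slice (hΩ : IsBoundedDomain 1 Ω) {G : ℝ × Space d → F}
    (hG : ContDiffOn ℝ ∞ G (cylinder Ω T)) {t : ℝ} (ht : t ∈ Icc 0 T) :
    MemLp (fun x => G (t, x)) 2 (volume.restrict Ω) :=
  memLp_of_continuousOn_closure hΩ.isOpen hΩ.isBounded (contDiffOn_slice hG ht).continuousOn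

open Asymptotics Filter Topology in
/-- A smooth field on the cylinder is differentiable in time as a curve in `L²`. -/
lemma hasDerivWithinAt_toL2 (hΩ : IsBoundedDomain 1 Ω) (hT : 0 < T) {G : ℝ × Space d → F}
    (hG : ContDiffOn ℝ ∞ G (cylinder Ω T)) {t : ℝ} (ht : t ∈ Icc 0 T) :
    HasDerivWithinAt (fun s => toL2 Ω fun x => G (s, x)) (toL2 Ω fun x => timeDeriv Ω T G (t, x))
      (Icc 0 T) t := by
  have hG' := contDiffOn_timeDeriv hΩ hT hG
  obtain ⟨C, hC0, hC⟩ := exists_lipschitz_time hΩ hT hG'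
  have hpt : ∀ s ∈ Icc 0 T, ∀ x ∈ Ω,
      ‖G (s, x) - G (t, x) - (s - t) • timeDeriv Ω T G (t, x)‖ ≤ C * |s - t| ^ 2 := by
    intro s hs x hx
    have hsub : uIcc t s ⊆ Icc 0 T := ordConnected_Icc.uIcc_subset ht hs
    have h1 := (convex_uIcc t s).norm_image_sub_le_of_norm_hasDerivWithin_le
      (f := fun r => G (r, x) - r • timeDeriv Ω T G (t, x))
      (f' := fun r => timeDeriv Ω T G (r, x) - (1 : ℝ) • timeDeriv Ω T G (t, x))
      (C := C * |s - t|)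
      (fun r hr => ((hasDerivWithinAt_timeDeriv hG (hsub hr) (subset_closure hx)).mono hsub).sub
        ((hasDerivAt_id r).smul_const _).hasDerivWithinAt)
      (fun r hr => ?_) left_mem_uIcc right_mem_uIcc
    · rw [Real.norm_eq_abs, mul_assoc, ← sq] at h1
      convert h1 using 2
      rw [sub_smul]; abel
    · rw [one_smul]
      refine (hC r (hsub hr) t ht x (subset_closure hx)).trans ?_
      exact mul_le_mul_of_nonneg_left (abs_sub_left_of_mem_uIcc hr) hC0
  rw [hasDerivWithinAt_iff_isLittleO]
  refine IsBigO.trans_isLittleO (g := fun s => ‖s - t‖ ^ 2) ?_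
    ((isLittleO_pow_sub_sub t one_lt_two).mono nhdsWithin_le_nhds)
  refine IsBigO.of_bound (C * √(volume.real Ω)) ?_
  filter_upwards [self_mem_nhdsWithin] with s hs
  have h2 : (toL2 Ω fun x => G (s, x)) - (toL2 Ω fun x => G (t, x)) -
      (s - t) • (toL2 Ω fun x => timeDeriv Ω T G (t, x)) =
      toL2 Ω fun x => G (s, x) - G (t, x) - (s - t) • timeDeriv Ω T G (t, x) := by
    rw [← toL2_sub (memLp_slice hΩ hG hs) (memLp_slice hΩ hG ht),
      ← toL2_const_smul _ (memLp_slice hΩ hG' ht), ← toL2_sub]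
    · exact (memLp_slice hΩ hG hs).sub (memLp_slice hΩ hG ht)
    · exact (memLp_slice hΩ hG' ht).const_smul _
  rw [h2]
  refine (norm_toL2_le hΩ.isOpen.measurableSet hΩ.isBounded.measure_lt_top.ne (by positivity)
    (hpt s hs)).trans_eq ?_
  simp only [Real.norm_eq_abs, abs_pow, abs_abs]
  ring

lemma timeDeriv_eq_derivWithin (hT : 0 < T) {G : ℝ × Space d → F}
    (hG : ContDiffOn ℝ ∞ G (cylinder Ω T)) {t : ℝ} (ht : t ∈ Icc 0 T) {x : Space d}
    (hx : x ∈ closure Ω) : timeDeriv Ω T G (t, x) = derivWithin (fun s => G (s, x)) (Icc 0 T) t :=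
  ((hasDerivWithinAt_timeDeriv hG ht hx).derivWithin (uniqueDiffOn_Icc hT t ht)).symm

lemma iteratedDeriv_two_eq (hΩ : IsBoundedDomain 1 Ω) (hT : 0 < T) {G : ℝ × Space d → F}
    (hG : ContDiffOn ℝ ∞ G (cylinder Ω T)) {t : ℝ} (ht : t ∈ Ioo 0 T) {x : Space d}
    (hx : x ∈ closure Ω) :
    iteratedDeriv 2 (fun s => G (s, x)) t = timeDeriv Ω T (timeDeriv Ω T G) (t, x) := by
  have hd : ∀ {G : ℝ × Space d → F}, ContDiffOn ℝ ∞ G (cylinder Ω T) → ∀ s ∈ Ioo 0 T,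
      HasDerivAt (fun s => G (s, x)) (timeDeriv Ω T G (s, x)) s := fun hG s hs =>
    (hasDerivWithinAt_timeDeriv hG (Ioo_subset_Icc_self hs) hx).hasDerivAt (Icc_mem_nhds hs.1 hs.2)
  rw [iteratedDeriv_succ, iteratedDeriv_one]
  have h : deriv (fun s => G (s, x)) =ᶠ[nhds t] fun s => timeDeriv Ω T G (s, x) :=
    Filter.mem_of_superset (Ioo_mem_nhds ht.1 ht.2) fun s hs => (hd hG s hs).deriv
  rw [h.deriv_eq]
  exact (hd (contDiffOn_timeDeriv hΩ hT hG) t ht).deriv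

lemma curl'_const_smul {c : ℝ} {p : Space d → CurlSpace d} {x : Space d}
    (hp : DifferentiableAt ℝ p x) : curl' (fun y => c • p y) x = c • curl' p x := by
  have h : fderiv ℝ (fun y => c • p y) x = c • fderiv ℝ p x := fderiv_fun_const_smul hp c
  simp_rw [curl', h, Finset.smul_sum]
  refine Finset.sum_congr rfl fun i _ => ?_
  rw [← crossL'_apply, ← crossL'_apply, smul_apply, map_smul]

lemma divergence_const_smul {c : ℝ} {u : Space d → Space d} {x : Space d}
    (hu : DifferentiableAt ℝ u x) : divergence (fun y => c • u y) x = c * divergence u x := by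
  have h : fderiv ℝ (fun y => c • u y) x = c • fderiv ℝ u x := fderiv_fun_const_smul hu c
  simp_rw [divergence, h, Finset.mul_sum]
  rfl

lemma curl'_congr (hΩ : IsOpen Ω) {p q : Space d → CurlSpace d} (h : ∀ x ∈ Ω, p x = q x)
    {x : Space d} (hx : x ∈ Ω) : curl' p x = curl' q x := by
  have : p =ᶠ[nhds x] q := Filter.mem_of_superset (hΩ.mem_nhds hx) h
  simp_rw [curl', this.fderiv_eq]

section Classical

variable {ε μ : ℝ} {φ ψ : Space d → Space d} {f : ℝ → Space d → CurlSpace d}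
  {E : ℝ → Space d → Space d}

/-- A classical solution satisfies the weak form of the wave equation, in which `X_N(Ω)` is the
space of test fields. -/
lemma IsClassicalSolution.weak (hE : IsClassicalSolution Ω T ε μ φ ψ f E)
    (hΩ : IsBoundedDomain 1 Ω) (hne : Ωᶜ.Nonempty) (hT : 0 < T) {v : L2 Ω (Space d)}
    (hv : HasTangentialTrace Ω v 0) {t : ℝ} (ht : t ∈ Ioo 0 T) :
    ε * ⟪toL2 Ω (fun x => timeDeriv Ω T (timeDeriv Ω T fun p => E p.1 p.2) (t, x)), v⟫ =
      -(μ⁻¹ * ⟪toL2 Ω (fun x => cylinderCurl Ω T (fun p => E p.1 p.2) (t, x)),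
        weakCurl Ω v⟫) := by
  have ht' := Ioo_subset_Icc_self ht
  have hG := hE.smooth
  set G : ℝ × Space d → Space d := fun p => E p.1 p.2 with hGdef
  have hp := contDiffOn_slice (contDiffOn_cylinderCurl hΩ hT hG) ht'
  have hGreen := hv.inner_weakCurl hΩ hne (hp.of_le (by simp))
  have hm := memLp_slice hΩ (contDiffOn_timeDeriv hΩ hT (contDiffOn_timeDeriv hΩ hT hG)) ht'
  have hc := memLp_curl' hΩ (hp.of_le (by simp))
  have e1 : -(μ⁻¹ • toL2 Ω (curl' fun x => cylinderCurl Ω T G (t, x))) =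
      toL2 Ω fun x => -μ⁻¹ • curl' (fun x => cylinderCurl Ω T G (t, x)) x := by
    rw [toL2_const_smul _ hc, neg_smul]
  rw [hGreen, ← real_inner_smul_left, ← real_inner_smul_left, ← inner_neg_left,
    ← toL2_const_smul _ hm, e1]
  congr 1
  refine toL2_congr hΩ.isOpen.measurableSet fun x hx => ?_
  have h1 := hE.maxwell t ht x hx
  rw [iteratedDeriv_two_eq (G := G) hΩ hT hG ht (subset_closure hx)] at h1
  have h2 : curl' (fun y => μ⁻¹ • curl (E t) y) x =
      curl' (fun y => μ⁻¹ • cylinderCurl Ω T G (t, y)) x :=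
    curl'_congr hΩ.isOpen (fun y hy => by
      rw [← curl_eq_cylinderCurl hΩ.isOpen hG ht' hy]) hx
  rw [h2, curl'_const_smul ((hp.differentiableOn (by simp)).differentiableAt
    (Filter.mem_of_superset (hΩ.isOpen.mem_nhds hx) subset_closure))] at h1
  rw [neg_smul]
  exact eq_neg_of_add_eq_zero_left h1

lemma IsClassicalSolution.hasWeakCurl (hE : IsClassicalSolution Ω T ε μ φ ψ f E)
    (hΩ : IsBoundedDomain 1 Ω) {t : ℝ} (ht : t ∈ Icc 0 T) :
    HasWeakCurl Ω (toL2 Ω (E t))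
      (toL2 Ω fun x => cylinderCurl Ω T (fun p => E p.1 p.2) (t, x)) := by
  have hEt : ContDiffOn ℝ 1 (E t) (closure Ω) := (contDiffOn_slice hE.smooth ht).of_le (by simp)
  have h := hasWeakCurl_toL2 hΩ.isOpen (hEt.mono subset_closure)
    (memLp_of_continuousOn_closure hΩ.isOpen hΩ.isBounded hEt.continuousOn) (memLp_curl hΩ hEt)
  rwa [toL2_congr hΩ.isOpen.measurableSet fun x hx =>
    curl_eq_cylinderCurl hΩ.isOpen hE.smooth ht hx] at h

lemma IsClassicalSolution.hasWeakDiv (hE : IsClassicalSolution Ω T ε μ φ ψ f E) (hε : ε ≠ 0)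
    (hΩ : IsBoundedDomain 1 Ω) {t : ℝ} (ht : t ∈ Ioo 0 T) :
    HasWeakDiv Ω (toL2 Ω (E t)) 0 := by
  have hEt : ContDiffOn ℝ 1 (E t) (closure Ω) :=
    (contDiffOn_slice hE.smooth (Ioo_subset_Icc_self ht)).of_le (by simp)
  have hdiv : ∀ x ∈ Ω, divergence (E t) x = 0 := fun x hx => by
    have h := hE.div t ht x hx
    rw [divergence_const_smul ((hEt.differentiableOn (by simp)).differentiableAt
      (Filter.mem_of_superset (hΩ.isOpen.mem_nhds hx) subset_closure))] at h
    exact (mul_eq_zero.1 h).resolve_left hε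
  have hm : MemLp (divergence (E t)) 2 (volume.restrict Ω) :=
    memLp_of_eqOn hΩ (c := fun _ => 0) continuousOn_const hdiv
  have h := hasWeakDiv_toL2 hΩ.isOpen (hEt.mono subset_closure)
    (memLp_of_continuousOn_closure hΩ.isOpen hΩ.isBounded hEt.continuousOn) hm
  have h0 : toL2 Ω (divergence (E t)) = 0 :=
    (toL2_congr (v := 0) hΩ.isOpen.measurableSet hdiv).trans toL2_zero
  exact h0 ▸ h

/-- The difference of two fields with the same tangential trace lies in `H₀(curl; Ω)`, if one of
them is of class `C¹` up to the boundary. -/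
lemma HasTangentialTrace.sub_toL2 (hΩ : IsBoundedDomain 1 Ω) {u : L2 Ω (Space d)}
    {g : Space d → CurlSpace d} (hu : HasTangentialTrace Ω u g) {v : Space d → Space d}
    (hv : ContDiffOn ℝ 1 v (closure Ω)) (hvg : HasClassicalTangentialTrace Ω v g) :
    HasTangentialTrace Ω (u - toL2 Ω v) 0 := by
  have hv2 := memLp_of_continuousOn_closure hΩ.isOpen hΩ.isBounded hv.continuousOn
  have hcv := hasWeakCurl_toL2 hΩ.isOpen (hv.mono subset_closure) hv2 (memLp_curl hΩ hv)
  have hc := hu.1.hasWeakCurl.sub hcv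
  refine ⟨⟨_, hc⟩, fun δ hδ => ?_⟩
  obtain ⟨w, hw, hwg, h1, h2⟩ := hu.2 δ hδ
  have hw2 := memLp_of_continuousOn_closure hΩ.isOpen hΩ.isBounded hw.continuousOn
  refine ⟨fun x => w x - v x, hw.sub hv, fun x hx n hn => ?_, ?_, ?_⟩
  · rw [← crossL_apply, map_sub, sub_apply, crossL_apply, crossL_apply, hwg x hx n hn,
      hvg x hx n hn, sub_self]; rfl
  · rwa [toL2_sub hw2 hv2, sub_sub_sub_cancel_right]
  · have h3 : toL2 Ω (curl fun x => w x - v x) = toL2 Ω (curl w) - toL2 Ω (curl v) := by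
      rw [← toL2_sub (memLp_curl hΩ hw) (memLp_curl hΩ hv)]
      refine toL2_congr hΩ.isOpen.measurableSet fun x hx => ?_
      have hn := Filter.mem_of_superset (hΩ.isOpen.mem_nhds hx) subset_closure
      have h4 : fderiv ℝ (fun x => w x - v x) x = fderiv ℝ w x - fderiv ℝ v x :=
        fderiv_fun_sub ((hw.differentiableOn one_ne_zero).differentiableAt hn)
          ((hv.differentiableOn one_ne_zero).differentiableAt hn)
      simp_rw [curl, h4, ← Finset.sum_sub_distrib, sub_apply, ← crossL_apply, map_sub]
    rwa [hc.weakCurl_eq hΩ.isOpen, h3, sub_sub_sub_cancel_right]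

end Classical

end TimeDependent

/-! ### Multiplication operators -/

section Multiplication

variable {Ω : Set (Space d)} {F : Type} [NormedAddCommGroup F]

/-- Bounded measurable functions act on `L²` by multiplication. -/
lemma exists_mulL2 [NormedSpace ℝ F] {β : Space d → ℝ} (hβ : Measurable β) {b : ℝ}
    (hb : ∀ x, |β x| ≤ b) :
    ∃ A : L2 Ω F →L[ℝ] L2 Ω F, ∀ u, A u =ᵐ[volume.restrict Ω] fun x => β x • u x := by
  have hβ' : MemLp β ⊤ (volume.restrict Ω) :=
    memLp_top_of_bound hβ.aestronglyMeasurable b (Filter.Eventually.of_forall hb)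
  have hm : ∀ u : L2 Ω F, MemLp (fun x => β x • u x) 2 (volume.restrict Ω) := fun u =>
    MemLp.smul (Lp.memLp u) hβ'
  let A₀ : L2 Ω F →ₗ[ℝ] L2 Ω F :=
    { toFun := fun u => (hm u).toLp
      map_add' := fun u v => by
        refine Lp.ext ?_
        filter_upwards [(hm (u + v)).coeFn_toLp, (hm u).coeFn_toLp, (hm v).coeFn_toLp,
          Lp.coeFn_add u v, Lp.coeFn_add ((hm u).toLp) ((hm v).toLp)] with x h1 h2 h3 h4 h5
        rw [h1, h5, Pi.add_apply, h2, h3, h4, Pi.add_apply, smul_add]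
      map_smul' := fun c u => by
        refine Lp.ext ?_
        filter_upwards [(hm (c • u)).coeFn_toLp, (hm u).coeFn_toLp,
          Lp.coeFn_smul c u, Lp.coeFn_smul c ((hm u).toLp)] with x h1 h2 h3 h4
        rw [h1, RingHom.id_apply, h4, Pi.smul_apply, h2, h3, Pi.smul_apply, smul_comm] }
  refine ⟨A₀.mkContinuous b fun u => ?_, fun u => (hm u).coeFn_toLp⟩
  refine Lp.norm_le_mul_norm_of_ae_le_mul ?_
  filter_upwards [(hm u).coeFn_toLp] with x hx
  change ‖((hm u).toLp : L2 Ω F) x‖ ≤ _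
  rw [hx, norm_smul]
  exact mul_le_mul_of_nonneg_right (hb x) (norm_nonneg _)

variable [InnerProductSpace ℝ F] {β : Space d → ℝ} {A : L2 Ω F →L[ℝ] L2 Ω F}

lemma inner_mulL2 (hA : ∀ u, A u =ᵐ[volume.restrict Ω] fun x => β x • u x) (u v : L2 Ω F) :
    ⟪A u, v⟫ = ∫ x in Ω, β x * ⟪u x, v x⟫ := by
  rw [L2.inner_def]
  refine integral_congr_ae ?_
  filter_upwards [hA u] with x hx
  rw [hx, real_inner_smul_left]

lemma inner_mulL2_comm (hA : ∀ u, A u =ᵐ[volume.restrict Ω] fun x => β x • u x) (u v : L2 Ω F) :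
    ⟪A u, v⟫ = ⟪u, A v⟫ := by
  rw [real_inner_comm (A v) u, inner_mulL2 hA, inner_mulL2 hA]
  simp_rw [real_inner_comm]

lemma le_inner_mulL2 (hA : ∀ u, A u =ᵐ[volume.restrict Ω] fun x => β x • u x) {a : ℝ}
    (ha : ∀ x, a ≤ β x) (u : L2 Ω F) : a * ‖u‖ ^ 2 ≤ ⟪A u, u⟫ := by
  rw [← real_inner_self_eq_norm_sq, ← real_inner_smul_left, L2.inner_def, L2.inner_def]
  refine integral_mono_ae (L2.integrable_inner (𝕜 := ℝ) _ _) (L2.integrable_inner (𝕜 := ℝ) _ _) ?_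
  filter_upwards [hA u, Lp.coeFn_smul a u] with x h1 h2
  rw [h1, h2, Pi.smul_apply, real_inner_smul_left, real_inner_smul_left]
  exact mul_le_mul_of_nonneg_right (ha x) real_inner_self_nonneg

end Multiplication

/-! ### The inhomogeneities -/

section Inclusions

variable {Ω : Set (Space d)} {m : ℕ} {μ₀ c₀ α : ℝ} {μ : Fin m → ℝ} {z : Fin m → Space d}
  {B : Fin m → Set (Space d)}

open scoped Pointwise in
lemma inclusion_eq (α : ℝ) (z : Space d) (B : Set (Space d)) :
    inclusion α z B = (fun y => z + y) '' (α • B) := by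
  rw [inclusion, ← image_smul, image_image]

open scoped Pointwise in
lemma isOpen_inclusion {z : Space d} {B : Set (Space d)} (hα : α ≠ 0) (hB : IsOpen B) :
    IsOpen (inclusion α z B) := by
  rw [inclusion_eq]
  exact (Homeomorph.addLeft z).isOpenMap _ (hB.smul₀ hα)

lemma volume_inclusion {z : Space d} {B : Set (Space d)} (hα : 0 < α) :
    volume (inclusion α z B) = ENNReal.ofReal (α ^ d) * volume B := by
  rw [inclusion_eq, image_add_left, measure_preimage_add, Measure.addHaar_smul,
    finrank_euclideanSpace_fin, abs_of_pos (by positivity)]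

lemma permeability_of_mem (hadm : IsAdmissible Ω c₀ α z B) {j : Fin m} {x : Space d}
    (hx : x ∈ inclusion α (z j) (B j)) : permeability μ₀ μ α z B x = μ j := by
  rw [permeability, indicator_of_notMem (by simpa using ⟨j, hx⟩), zero_add,
    Finset.sum_eq_single j, indicator_of_mem hx]
  · exact fun l _ hl => indicator_of_notMem
      (fun h => disjoint_left.1 (hadm.disjoint hl) h hx) _
  · simp

lemma permeability_of_notMem {x : Space d} (hx : x ∉ ⋃ j, inclusion α (z j) (B j)) :
    permeability μ₀ μ α z B x = μ₀ := by
  rw [permeability, indicator_of_mem hx, Finset.sum_eq_zero, add_zero]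
  exact fun j _ => indicator_of_notMem (fun h => hx (mem_iUnion.2 ⟨j, h⟩)) _

lemma permeability_cases (hadm : IsAdmissible Ω c₀ α z B) (x : Space d) :
    permeability μ₀ μ α z B x = μ₀ ∨ ∃ j, permeability μ₀ μ α z B x = μ j := by
  by_cases hx : x ∈ ⋃ j, inclusion α (z j) (B j)
  · obtain ⟨j, hj⟩ := mem_iUnion.1 hx
    exact Or.inr ⟨j, permeability_of_mem hadm hj⟩
  · exact Or.inl (permeability_of_notMem hx)

lemma measurable_permeability (hα : α ≠ 0) (hB : ∀ j, IsOpen (B j)) :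
    Measurable (permeability μ₀ μ α z B) := by
  have hm : ∀ j, MeasurableSet (inclusion α (z j) (B j)) := fun j =>
    (isOpen_inclusion hα (hB j)).measurableSet
  exact (measurable_const.indicator (MeasurableSet.iUnion hm).compl).add
    (Finset.measurable_fun_sum _ fun j _ => measurable_const.indicator (hm j))

lemma permeability_inv_mem (hμ₀ : 0 < μ₀) (hμ : ∀ j, 0 < μ j) (hadm : IsAdmissible Ω c₀ α z B)
    (x : Space d) : (permeability μ₀ μ α z B x)⁻¹ ∈
      Icc (μ₀ + ∑ j, μ j)⁻¹ (μ₀⁻¹ + ∑ j, (μ j)⁻¹) := by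
  have h1 : 0 ≤ ∑ j, μ j := Finset.sum_nonneg fun j _ => (hμ j).le
  have h2 : ∀ j, μ j ≤ ∑ j, μ j := fun j =>
    Finset.single_le_sum (fun j _ => (hμ j).le) (Finset.mem_univ j)
  have h3 : 0 ≤ ∑ j, (μ j)⁻¹ := Finset.sum_nonneg fun j _ => (inv_pos.2 (hμ j)).le
  have h4 : ∀ j, (μ j)⁻¹ ≤ ∑ j, (μ j)⁻¹ := fun j =>
    Finset.single_le_sum (f := fun j => (μ j)⁻¹) (fun j _ => (inv_pos.2 (hμ j)).le)
      (Finset.mem_univ j)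
  rcases permeability_cases (μ₀ := μ₀) (μ := μ) hadm x with h | ⟨j, h⟩
  · rw [h]
    exact ⟨inv_anti₀ hμ₀ (by linarith), by linarith⟩
  · rw [h]
    exact ⟨inv_anti₀ (hμ j) (by linarith [h2 j]), by linarith [h4 j, inv_pos.2 hμ₀]⟩

lemma abs_permeability_inv_sub_le (hμ₀ : 0 < μ₀) (hμ : ∀ j, 0 < μ j)
    (hadm : IsAdmissible Ω c₀ α z B) (x : Space d) :
    |(permeability μ₀ μ α z B x)⁻¹ - μ₀⁻¹| ≤
      (⋃ j, inclusion α (z j) (B j)).indicator (fun _ => μ₀⁻¹ + ∑ j, (μ j)⁻¹) x := by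
  by_cases hx : x ∈ ⋃ j, inclusion α (z j) (B j)
  · rw [indicator_of_mem hx]
    have h1 := permeability_inv_mem hμ₀ hμ hadm x
    have h2 : 0 < (μ₀ + ∑ j, μ j)⁻¹ :=
      inv_pos.2 (add_pos_of_pos_of_nonneg hμ₀ (Finset.sum_nonneg fun j _ => (hμ j).le))
    have h3 : 0 ≤ ∑ j, (μ j)⁻¹ := Finset.sum_nonneg fun j _ => (inv_pos.2 (hμ j)).le
    rw [abs_le]
    constructor <;> linarith [h1.1, h1.2, inv_pos.2 hμ₀]
  · rw [indicator_of_notMem hx, permeability_of_notMem hx, sub_self, abs_zero]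

lemma inclusion_subset_closure (hc₀ : 0 < c₀) (hadm : IsAdmissible Ω c₀ α z B) (j : Fin m) :
    inclusion α (z j) (B j) ⊆ closure Ω := by
  intro x hx
  by_contra h
  have h1 := hadm.dist j x hx
  rw [Metric.infDist_zero_of_mem h] at h1
  linarith

/-- An inhomogeneity which fits into the bounded set `Ω` has bounded size. -/
lemma exists_size_le (hd : 0 < d) (hΩ : Bornology.IsBounded Ω) (hc₀ : 0 < c₀) {j : Fin m}
    (hB : IsOpen (B j)) (h0 : 0 ∈ B j) :
    ∃ R : ℝ, ∀ α z, IsAdmissible Ω c₀ α z B → α ≤ R := by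
  obtain ⟨r, hr, hball⟩ := Metric.isOpen_iff.1 hB 0 h0
  refine ⟨Metric.diam (closure Ω) / (r / 2), fun α z hadm => ?_⟩
  set e : Space d := EuclideanSpace.single ⟨0, hd⟩ 1 with he
  have hne : ‖(r / 2) • e‖ = r / 2 := by
    rw [norm_smul, he, norm_single_one, mul_one, Real.norm_of_nonneg (by linarith)]
  have h1 : z j + α • (0 : Space d) ∈ closure Ω :=
    inclusion_subset_closure hc₀ hadm j ⟨0, h0, rfl⟩
  have h2 : z j + α • ((r / 2) • e) ∈ closure Ω := by
    refine inclusion_subset_closure hc₀ hadm j ⟨(r / 2) • e, hball ?_, rfl⟩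
    rw [mem_ball_zero_iff, hne]
    linarith
  have h3 := Metric.dist_le_diam_of_mem hΩ.closure h2 h1
  rw [dist_eq_norm, smul_zero, add_zero, add_sub_cancel_left, norm_smul, hne,
    Real.norm_of_nonneg hadm.pos.le] at h3
  rwa [le_div_iff₀ (by positivity)]

/-- The square root of the volume of the inhomogeneities is `O(α)`. In dimension two it is of this
order, in dimension three it is `O(α ^ (3 / 2))`. -/
lemma exists_sqrt_volume_le (hd : 2 ≤ d ∧ d ≤ 3) (hΩ : Bornology.IsBounded Ω) (hc₀ : 0 < c₀)
    (hB : ∀ j, IsOpen (B j)) (hBb : ∀ j, Bornology.IsBounded (B j)) (h0 : ∀ j, 0 ∈ B j) :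
    ∃ κ : ℝ, 0 ≤ κ ∧ ∀ α z, IsAdmissible Ω c₀ α z B →
      volume (⋃ j, inclusion α (z j) (B j)) ≠ ⊤ ∧
      √(volume.real (⋃ j, inclusion α (z j) (B j))) ≤ κ * α := by
  choose R hR using fun j => exists_size_le (j := j) (by omega) hΩ hc₀ (hB j) (h0 j)
  refine ⟨√(∑ j, (1 + |R j|) * volume.real (B j)), Real.sqrt_nonneg _, fun α z hadm => ?_⟩
  have hα := hadm.pos
  have hreal : ∀ j, volume.real (inclusion α (z j) (B j)) = α ^ d * volume.real (B j) := by
    intro j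
    rw [Measure.real, volume_inclusion hα, ENNReal.toReal_mul,
      ENNReal.toReal_ofReal (by positivity), Measure.real]
  have hpow : ∀ j, α ^ d ≤ α ^ 2 * (1 + |R j|) := by
    intro j
    have h1 : α ≤ |R j| := (hR j α z hadm).trans (le_abs_self _)
    obtain rfl | rfl : d = 2 ∨ d = 3 := by omega
    · nlinarith [sq_nonneg α, abs_nonneg (R j)]
    · nlinarith [sq_nonneg α]
  refine ⟨?_, ?_⟩
  · refine ((measure_iUnion_le _).trans_lt ?_).ne
    rw [tsum_fintype]
    refine ENNReal.sum_lt_top.2 fun j _ => ?_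
    rw [volume_inclusion hα]
    exact ENNReal.mul_lt_top ENNReal.ofReal_lt_top (hBb j).measure_lt_top
  · rw [← Real.sqrt_sq hα.le, ← Real.sqrt_mul' _ (sq_nonneg _), Real.sqrt_sq hα.le]
    refine Real.sqrt_le_sqrt ((measureReal_iUnion_fintype_le _).trans ?_)
    rw [Finset.sum_mul]
    refine Finset.sum_le_sum fun j _ => ?_
    rw [hreal]
    calc α ^ d * volume.real (B j) ≤ α ^ 2 * (1 + |R j|) * volume.real (B j) :=
          mul_le_mul_of_nonneg_right (hpow j) measureReal_nonneg
      _ = (1 + |R j|) * volume.real (B j) * α ^ 2 := by ring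

end Inclusions

/-! ### The difference of the perturbed and the unperturbed field -/

section Difference

variable {Ω : Set (Space d)} {T ε μ : ℝ} {ν : Space d → ℝ} {φ ψ : Space d → Space d}
  {f : ℝ → Space d → CurlSpace d} {E : ℝ → Space d → Space d} {u : ℝ → L2 Ω (Space d)}

lemma MemH1.hasWeakCurl {u : L2 Ω (Space d)} (hu : MemH1 Ω u) :
    HasWeakCurl Ω u
      (∑ i, (crossL d (EuclideanSpace.single i 1)).compLpL 2 _ (weakPartial Ω i u)) := by
  refine hasWeakCurl_of_hasWeakPartial fun i => ?_
  rw [weakPartial, dif_pos (hu i)]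
  exact (hu i).choose_spec

lemma IsWeakSolution.hasWeakCurl (hu : IsWeakSolution Ω T ε ν φ ψ f u) {t : ℝ}
    (ht : t ∈ Icc 0 T) : HasWeakCurl Ω (u t) (weakCurl Ω (u t)) :=
  MemHcurl.hasWeakCurl ⟨_, (hu.memH1 t ht).hasWeakCurl⟩

lemma IsWeakSolution.continuousOn_weakCurl (hu : IsWeakSolution Ω T ε ν φ ψ f u)
    (hΩ : IsOpen Ω) : ContinuousOn (fun t => weakCurl Ω (u t)) (Icc 0 T) := by
  refine ContinuousOn.congr (f := fun t => ∑ i,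
    (crossL d (EuclideanSpace.single i 1)).compLpL 2 (volume.restrict Ω)
      (weakPartial Ω i (u t))) ?_ fun t ht => (hu.memH1 t ht).hasWeakCurl.weakCurl_eq hΩ
  exact continuousOn_finsetSum _ fun i _ =>
    (ContinuousLinearMap.continuous _).comp_continuousOn (hu.continuousOn i)

variable (hu : IsWeakSolution Ω T ε ν φ ψ f u) (hE : IsClassicalSolution Ω T ε μ φ ψ f E)
  (hΩ : IsBoundedDomain 1 Ω)

include hu hE hΩ

lemma hasWeakCurl_sub {t : ℝ} (ht : t ∈ Icc 0 T) :
    HasWeakCurl Ω (u t - toL2 Ω (E t)) (weakCurl Ω (u t) -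
      toL2 Ω fun x => cylinderCurl Ω T (fun p => E p.1 p.2) (t, x)) :=
  (hu.hasWeakCurl ht).sub (hE.hasWeakCurl hΩ ht)

lemma hasWeakDiv_sub (hε : ε ≠ 0) {t : ℝ} (ht : t ∈ Ioo 0 T) :
    HasWeakDiv Ω (u t - toL2 Ω (E t)) 0 := by
  simpa using ((hu.div t (Ioo_subset_Icc_self ht)).of_const_smul hε).sub (hE.hasWeakDiv hε hΩ ht)

lemma memXN_sub (hε : ε ≠ 0) {t : ℝ} (ht : t ∈ Ioo 0 T) : MemXN Ω (u t - toL2 Ω (E t)) :=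
  ⟨⟨_, hasWeakCurl_sub hu hE hΩ (Ioo_subset_Icc_self ht)⟩, ⟨_, hasWeakDiv_sub hu hE hΩ hε ht⟩,
    (hu.boundary t ht).sub_toL2 hΩ
      ((contDiffOn_slice hE.smooth (Ioo_subset_Icc_self ht)).of_le (by simp)) (hE.boundary t ht)⟩

lemma hasDerivWithinAt_sub (hT : 0 < T) {t : ℝ} (ht : t ∈ Icc 0 T) :
    HasDerivWithinAt (fun t => u t - toL2 Ω (E t)) (derivWithin u (Icc 0 T) t -
      toL2 Ω fun x => timeDeriv Ω T (fun p => E p.1 p.2) (t, x)) (Icc 0 T) t :=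
  ((hu.contDiffOn.differentiableOn one_ne_zero t ht).hasDerivWithinAt).sub
    (hasDerivWithinAt_toL2 hΩ hT hE.smooth ht)

lemma continuousOn_derivWithin_sub (hT : 0 < T) :
    ContinuousOn (fun t => derivWithin u (Icc 0 T) t -
      toL2 Ω fun x => timeDeriv Ω T (fun p => E p.1 p.2) (t, x)) (Icc 0 T) :=
  (hu.contDiffOn.continuousOn_derivWithin (uniqueDiffOn_Icc hT) le_rfl).sub fun _ ht =>
    (hasDerivWithinAt_toL2 hΩ hT (contDiffOn_timeDeriv hΩ hT hE.smooth) ht).continuousWithinAt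

lemma initial_eq : u 0 = toL2 Ω (E 0) := by
  rw [hu.initial]
  exact toL2_congr hΩ.isOpen.measurableSet fun x hx => (hE.initial x hx).symm

lemma initial_deriv_eq (hT : 0 < T) : derivWithin u (Icc 0 T) 0 =
    toL2 Ω fun x => timeDeriv Ω T (fun p => E p.1 p.2) (0, x) := by
  rw [hu.initial_deriv]
  refine toL2_congr hΩ.isOpen.measurableSet fun x hx => ?_
  rw [timeDeriv_eq_derivWithin hT hE.smooth ⟨le_rfl, hT.le⟩ (subset_closure hx),
    hE.initial_deriv x hx]

/-- The weak equation for the difference `w = u - E`: the contrast between the permeabilities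
acts on the curl of the smooth field `E` as a source. -/
lemma hasDerivAt_inner_sub (hne : Ωᶜ.Nonempty) (hT : 0 < T)
    {A : L2 Ω (CurlSpace d) →L[ℝ] L2 Ω (CurlSpace d)}
    (hA : ∀ c, A c =ᵐ[volume.restrict Ω] fun x => (ν x)⁻¹ • c x) {v : L2 Ω (Space d)}
    (hv : MemXN Ω v) {t : ℝ} (ht : t ∈ Ioo 0 T) :
    HasDerivAt (fun s => ε * ⟪derivWithin u (Icc 0 T) s -
        toL2 Ω fun x => timeDeriv Ω T (fun p => E p.1 p.2) (s, x), v⟫)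
      (-⟪A (weakCurl Ω (u t) - toL2 Ω fun x => cylinderCurl Ω T (fun p => E p.1 p.2) (t, x)) +
        (A (toL2 Ω fun x => cylinderCurl Ω T (fun p => E p.1 p.2) (t, x)) -
          μ⁻¹ • toL2 Ω fun x => cylinderCurl Ω T (fun p => E p.1 p.2) (t, x)),
        weakCurl Ω v⟫) t := by
  have h1 := hu.maxwell v hv t ht
  rw [← inner_mulL2 hA] at h1
  have h2 := (hasDerivWithinAt_toL2 hΩ hT (contDiffOn_timeDeriv hΩ hT hE.smooth)
    (Ioo_subset_Icc_self ht)).hasDerivAt (Icc_mem_nhds ht.1 ht.2)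
  have h3 := (h2.inner ℝ (hasDerivAt_const t v)).const_mul ε
  rw [inner_zero_right, zero_add, hE.weak hΩ hne hT hv.trace ht] at h3
  have h4 := h1.sub h3
  simp_rw [inner_sub_left, mul_sub]
  refine h4.congr_deriv ?_
  rw [map_sub, inner_add_left, inner_sub_left, inner_sub_left, real_inner_smul_left]
  ring

end Difference

/-- The source has the size of the square root of the volume of the inhomogeneities. -/
lemma norm_contrast_le {Ω : Set (Space d)} {m : ℕ} {μ₀ c₀ α : ℝ} {μ : Fin m → ℝ}
    {z : Fin m → Space d} {B : Fin m → Set (Space d)} (hΩ : IsOpen Ω) (hμ₀ : 0 < μ₀)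
    (hμ : ∀ j, 0 < μ j) (hadm : IsAdmissible Ω c₀ α z B) (hB : ∀ j, IsOpen (B j))
    (hfin : volume (⋃ j, inclusion α (z j) (B j)) ≠ ⊤)
    {A : L2 Ω (CurlSpace d) →L[ℝ] L2 Ω (CurlSpace d)}
    (hA : ∀ c, A c =ᵐ[volume.restrict Ω] fun x => (permeability μ₀ μ α z B x)⁻¹ • c x)
    {q : Space d → CurlSpace d} (hq : MemLp q 2 (volume.restrict Ω)) {N : ℝ} (hN : 0 ≤ N)
    (hqN : ∀ x ∈ Ω, ‖q x‖ ≤ N) :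
    ‖A (toL2 Ω q) - μ₀⁻¹ • toL2 Ω q‖ ≤
      (μ₀⁻¹ + ∑ j, (μ j)⁻¹) * N * √(volume.real (⋃ j, inclusion α (z j) (B j))) := by
  have hb : 0 ≤ μ₀⁻¹ + ∑ j, (μ j)⁻¹ :=
    add_nonneg (inv_pos.2 hμ₀).le (Finset.sum_nonneg fun j _ => (inv_pos.2 (hμ j)).le)
  have hm : MeasurableSet (⋃ j, inclusion α (z j) (B j)) :=
    MeasurableSet.iUnion fun j => (isOpen_inclusion hadm.pos.ne' (hB j)).measurableSet
  refine norm_L2_le (by positivity) hm hfin ?_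
  filter_upwards [Lp.coeFn_sub (A (toL2 Ω q)) (μ₀⁻¹ • toL2 Ω q), Lp.coeFn_smul μ₀⁻¹ (toL2 Ω q),
    hA (toL2 Ω q), coeFn_toL2 hq, ae_restrict_mem hΩ.measurableSet] with x h1 h2 h3 h4 hx
  rw [h1, Pi.sub_apply, h2, h3, Pi.smul_apply, h4, ← sub_smul, norm_smul, Real.norm_eq_abs]
  refine (mul_le_mul (abs_permeability_inv_sub_le hμ₀ hμ hadm x) (hqN x hx) (norm_nonneg _)
    (indicator_nonneg (fun _ _ => hb) x)).trans_eq ?_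
  by_cases hxU : x ∈ ⋃ j, inclusion α (z j) (B j)
  · rw [indicator_of_mem hxU, indicator_of_mem hxU]
  · rw [indicator_of_notMem hxU, indicator_of_notMem hxU, zero_mul]

lemma nonempty_compl_of_isBounded (hd : 0 < d) {Ω : Set (Space d)}
    (hΩ : Bornology.IsBounded Ω) : Ωᶜ.Nonempty := by
  have : Nonempty (Fin d) := ⟨⟨0, hd⟩⟩
  rw [nonempty_compl]
  rintro rfl
  exact NormedSpace.unbounded_univ ℝ (Space d) hΩ

/-- The estimates for each time, with a constant that depends neither on `α` nor on the points. -/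
lemma exists_pointwise_estimate (hd : 2 ≤ d ∧ d ≤ 3) {Ω : Set (Space d)}
    (hΩ : IsBoundedDomain 1 Ω) {T ε₀ μ₀ c₀ : ℝ} (hT : 0 < T) (hε₀ : 0 < ε₀) (hμ₀ : 0 < μ₀)
    (hc₀ : 0 < c₀) {m : ℕ} {B : Fin m → Set (Space d)} (hB : ∀ j, IsOpen (B j))
    (hBb : ∀ j, Bornology.IsBounded (B j)) (h0 : ∀ j, 0 ∈ B j) {μ : Fin m → ℝ}
    (hμ : ∀ j, 0 < μ j) {φ ψ : Space d → Space d} {f : ℝ → Space d → CurlSpace d}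
    {E : ℝ → Space d → Space d} (hE : IsClassicalSolution Ω T ε₀ μ₀ φ ψ f E) :
    ∃ P Q : ℝ, 0 ≤ P ∧ 0 ≤ Q ∧ ∀ (α : ℝ) (z : Fin m → Space d), IsAdmissible Ω c₀ α z B →
      ∀ u : ℝ → L2 Ω (Space d), IsWeakSolution Ω T ε₀ (permeability μ₀ μ α z B) φ ψ f u →
      ∀ t ∈ Icc 0 T,
        ‖derivWithin u (Icc 0 T) t -
          toL2 Ω fun x => timeDeriv Ω T (fun p => E p.1 p.2) (t, x)‖ ≤ P * α ∧
        ‖weakCurl Ω (u t) -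
          toL2 Ω fun x => cylinderCurl Ω T (fun p => E p.1 p.2) (t, x)‖ ≤ Q * α := by
  have hne := nonempty_compl_of_isBounded (by omega) hΩ.isBounded
  set G : ℝ × Space d → Space d := fun p => E p.1 p.2 with hG
  have hcG := contDiffOn_cylinderCurl hΩ hT hE.smooth
  obtain ⟨C₀, hC₀, hC₀'⟩ := exists_norm_le_cylinder hΩ.isBounded hcG
  obtain ⟨C₁, hC₁, hC₁'⟩ := exists_lipschitz_time hΩ hT hcG
  obtain ⟨κ, hκ, hκ'⟩ := exists_sqrt_volume_le hd hΩ.isBounded hc₀ hB hBb h0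
  set b := μ₀⁻¹ + ∑ j, (μ j)⁻¹ with hb
  set a := (μ₀ + ∑ j, μ j)⁻¹ with ha
  have hb0 : 0 ≤ b :=
    add_nonneg (inv_pos.2 hμ₀).le (Finset.sum_nonneg fun j _ => (inv_pos.2 (hμ j)).le)
  have ha0 : 0 < a :=
    inv_pos.2 (add_pos_of_pos_of_nonneg hμ₀ (Finset.sum_nonneg fun j _ => (hμ j).le))
  refine ⟨2 * (b * C₀ * κ + b * C₁ * κ * T) / √(ε₀ * a),
    2 * (b * C₀ * κ + b * C₁ * κ * T) / a, by positivity, by positivity, ?_⟩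
  intro α z hadm u hu t ht
  have hα := hadm.pos.le
  obtain ⟨hfin, hvol⟩ := hκ' α z hadm
  obtain ⟨A, hA⟩ := exists_mulL2 (Ω := Ω) (F := CurlSpace d)
    (β := fun x => (permeability μ₀ μ α z B x)⁻¹)
    (measurable_permeability hadm.pos.ne' hB).inv (b := b) (fun x => by
      have h := permeability_inv_mem hμ₀ hμ hadm x
      rw [abs_of_nonneg (ha0.le.trans h.1)]
      exact h.2)
  have hcont : ∀ (q : Space d → CurlSpace d), MemLp q 2 (volume.restrict Ω) → ∀ N, 0 ≤ N →
      (∀ x ∈ Ω, ‖q x‖ ≤ N) → ‖A (toL2 Ω q) - μ₀⁻¹ • toL2 Ω q‖ ≤ b * N * (κ * α) :=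
    fun q hq N hN hqN => (norm_contrast_le hΩ.isOpen hμ₀ hμ hadm hB hfin hA hq hN hqN).trans
      (mul_le_mul_of_nonneg_left hvol (by positivity))
  have hXN := fun {s : ℝ} (hs : s ∈ Ioo 0 T) => memXN_sub hu hE hΩ hε₀.ne' hs
  have hcurl := fun {s : ℝ} (hs : s ∈ Icc 0 T) =>
    (hasWeakCurl_sub hu hE hΩ hs).weakCurl_eq hΩ.isOpen
  have key := energy_estimate (T := T) (ε := ε₀) (a := a) (L := b * C₁ * (κ * α))
    (G := b * C₀ * (κ * α)) hT hε₀ ha0 (by positivity) (A := A) (inner_mulL2_comm hA)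
    (le_inner_mulL2 hA fun x => (permeability_inv_mem hμ₀ hμ hadm x).1)
    (w := fun t => u t - toL2 Ω (E t))
    (p := fun t => derivWithin u (Icc 0 T) t - toL2 Ω fun x => timeDeriv Ω T G (t, x))
    (c := fun t => weakCurl Ω (u t) - toL2 Ω fun x => cylinderCurl Ω T G (t, x))
    (g := fun t => A (toL2 Ω fun x => cylinderCurl Ω T G (t, x)) -
      μ₀⁻¹ • toL2 Ω fun x => cylinderCurl Ω T G (t, x))
    (fun s hs => (hasDerivWithinAt_sub hu hE hΩ hT (Ioo_subset_Icc_self hs)).hasDerivAt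
      (Icc_mem_nhds hs.1 hs.2))
    (continuousOn_derivWithin_sub hu hE hΩ hT)
    ((hu.continuousOn_weakCurl hΩ.isOpen).sub fun s hs =>
      (hasDerivWithinAt_toL2 hΩ hT hcG hs).continuousWithinAt)
    (fun s hs r hr => ?_)
    (fun s hs => hcont _ (memLp_slice hΩ hcG hs) C₀ hC₀ fun x hx =>
      hC₀' s hs x (subset_closure hx))
    (sub_eq_zero.2 (initial_deriv_eq hu hE hΩ hT)) ?_ (fun s hs r hr q hq => ?_) ht
  · have e : b * C₀ * (κ * α) + b * C₁ * (κ * α) * T =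
        (b * C₀ * κ + b * C₁ * κ * T) * α := by ring
    rw [e] at key
    refine ⟨key.2.trans_eq (by ring), key.1.trans_eq (by ring)⟩
  · have h1 := hcont (fun x => cylinderCurl Ω T G (s, x) - cylinderCurl Ω T G (r, x))
      ((memLp_slice hΩ hcG hs).sub (memLp_slice hΩ hcG hr)) (C₁ * |s - r|) (by positivity)
      fun x hx => hC₁' s hs r hr x (subset_closure hx)
    rw [toL2_sub (memLp_slice hΩ hcG hs) (memLp_slice hΩ hcG hr), map_sub, smul_sub] at h1
    refine le_of_eq_of_le (congrArg norm ?_) (h1.trans_eq (by ring))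
    abel
  · have hmem : (0 : ℝ) ∈ Icc 0 T := ⟨le_rfl, hT.le⟩
    rw [initial_eq hu hE hΩ, (hE.hasWeakCurl hΩ hmem).weakCurl_eq hΩ.isOpen, sub_self]
  · have h1 := hasDerivAt_inner_sub hu hE hΩ hne hT hA (hXN hr) hq
    have h2 := hasDerivAt_inner_sub hu hE hΩ hne hT hA (hXN hs) hq
    rw [hcurl (Ioo_subset_Icc_self hr)] at h1
    rw [hcurl (Ioo_subset_Icc_self hs)] at h2
    have h3 := h1.sub h2
    simp_rw [inner_sub_right _ (u r - toL2 Ω (E r)), mul_sub]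
    refine h3.congr_deriv ?_
    rw [inner_sub_right _ (weakCurl Ω (u r) - _)]
    ring

end

end Maxwell

theorem mainTheorem4 (d : ℕ) (hd : d = 2 ∨ d = 3)
    (Ω : Set (Space d)) (hΩ : IsBoundedDomain 2 Ω)
    (T ε₀ μ₀ c₀ : ℝ) (hT : 0 < T) (hε₀ : 0 < ε₀) (hμ₀ : 0 < μ₀) (hc₀ : 0 < c₀)
    (m : ℕ) (B : Fin m → Set (Space d)) (hB : ∀ j, IsBoundedDomain ∞ (B j) ∧ 0 ∈ B j)
    (μ : Fin m → ℝ) (hμ : ∀ j, 0 < μ j)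
    (φ ψ : Space d → Space d) (f : ℝ → Space d → CurlSpace d)
    (E : ℝ → Space d → Space d) (hE : IsClassicalSolution Ω T ε₀ μ₀ φ ψ f E) :
    ∃ C : ℝ, 0 < C ∧
      ∀ (α : ℝ) (z : Fin m → Space d), IsSeparated Ω c₀ z → IsAdmissible Ω c₀ α z B →
      ∀ Eα : ℝ → L2 Ω (Space d),
        IsWeakSolution Ω T ε₀ (permeability μ₀ μ α z B) φ ψ f Eα →
        essSup (fun t => ‖derivWithin Eα (Icc 0 T) t -
              toL2 Ω (fun x => derivWithin (fun s => E s x) (Icc 0 T) t)‖ₑ)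
            (volume.restrict (Ioo 0 T)) +
          essSup (fun t => normXN Ω (Eα t - toL2 Ω (E t))) (volume.restrict (Ioo 0 T))
        ≤ ENNReal.ofReal (C * α) := by
  have hΩ1 : IsBoundedDomain 1 Ω := hΩ.mono one_le_two
  obtain ⟨P, Q, hP, hQ, hest⟩ := exists_pointwise_estimate (by omega) hΩ1 hT hε₀ hμ₀ hc₀
    (fun j => (hB j).1.isOpen) (fun j => (hB j).1.isBounded) (fun j => (hB j).2) hμ hE
  refine ⟨P + √((P * T) ^ 2 + Q ^ 2) + 1, by positivity, fun α z _ hadm u hu => ?_⟩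
  have hα := hadm.pos.le
  have hest' := hest α z hadm u hu
  have hw0 : u 0 - toL2 Ω (E 0) = 0 := sub_eq_zero.2 (initial_eq hu hE hΩ1)
  have h1 : essSup (fun t => ‖derivWithin u (Icc 0 T) t -
      toL2 Ω (fun x => derivWithin (fun s => E s x) (Icc 0 T) t)‖ₑ)
      (volume.restrict (Ioo 0 T)) ≤ ENNReal.ofReal (P * α) := by
    refine essSup_le_of_ae_le _ ?_
    filter_upwards [ae_restrict_mem measurableSet_Ioo] with t ht
    have ht' := Ioo_subset_Icc_self ht
    have h2 : (toL2 Ω fun x => derivWithin (fun s => E s x) (Icc 0 T) t) =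
        toL2 Ω fun x => timeDeriv Ω T (fun p => E p.1 p.2) (t, x) :=
      toL2_congr hΩ.isOpen.measurableSet fun x hx =>
        (timeDeriv_eq_derivWithin hT hE.smooth ht' (subset_closure hx)).symm
    rw [h2, ← ofReal_norm]
    exact ENNReal.ofReal_le_ofReal (hest' t ht').1
  have h2 : essSup (fun t => normXN Ω (u t - toL2 Ω (E t))) (volume.restrict (Ioo 0 T)) ≤
      ENNReal.ofReal (√((P * T) ^ 2 + Q ^ 2) * α) := by
    refine essSup_le_of_ae_le _ ?_
    filter_upwards [ae_restrict_mem measurableSet_Ioo] with t ht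
    have ht' := Ioo_subset_Icc_self ht
    have hwt : ‖u t - toL2 Ω (E t)‖ ≤ P * T * α := by
      have h3 := (convex_Icc 0 T).norm_image_sub_le_of_norm_hasDerivWithin_le
        (fun s hs => hasDerivWithinAt_sub hu hE hΩ1 hT hs) (fun s hs => (hest' s hs).1)
        (left_mem_Icc.2 hT.le) ht'
      simp only [hw0, sub_zero] at h3
      rw [Real.norm_of_nonneg ht.1.le] at h3
      calc _ ≤ P * α * t := h3
        _ ≤ P * α * T := by gcongr; exact ht.2.le
        _ = P * T * α := by ring
    have hct := (hest' t ht').2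
    rw [normXN, if_pos (memXN_sub hu hE hΩ1 hε₀.ne' ht),
      (hasWeakCurl_sub hu hE hΩ1 ht').weakCurl_eq hΩ.isOpen,
      (hasWeakDiv_sub hu hE hΩ1 hε₀.ne' ht).weakDiv_eq hΩ.isOpen]
    refine ENNReal.ofReal_le_ofReal ?_
    rw [← Real.sqrt_sq hα, ← Real.sqrt_mul (by positivity)]
    refine Real.sqrt_le_sqrt ?_
    rw [norm_zero]
    have h4 := pow_le_pow_left₀ (norm_nonneg _) hwt 2
    have h5 := pow_le_pow_left₀ (norm_nonneg _) hct 2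
    linarith
  refine (add_le_add h1 h2).trans ?_
  rw [← ENNReal.ofReal_add (by positivity) (by positivity)]
  refine ENNReal.ofReal_le_ofReal ?_
  linarith
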